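/- Let $k$ be an algebraically closed field of characteristic zero. For a finite group $G$ write $kG$ for its group algebra and $k^G$ for the linear dual of $kG$, with basis $\{e_g\}_{g\in G}$ dual to $G$. The Drinfel'd double $D(G)$ is the Hopf algebra over $k$ with basis $e_g\# h$ $(g,h\in G)$, multiplication $(e_g\# g')(e_h\# h')=\delta_{g,\,g'hg'^{-1}}\,e_g\# g'h'$, identity $\varepsilon\# 1$ where $\varepsilon=\sum_{g} e_g$, comultiplication $\Delta(e_g\# h)=\sum_{ba=g}(e_a\# h)\otimes(e_b\# h)$ and counit $e_g\# h\mapsto\delta_{g,1}$. (As a coalgebra, $D(G)=(k^G)^{\mathrm{cop}}\otimes kG$.) For finite groups $G,H$, the components of a morphism of Hopf algebras $\psi\colon D(G)\to D(H)$ are the linear maps $$u\colon k^G\to k^H,\; u(a)=(\mathrm{id}\otimes\varepsilon_{kH})\psi(a\#1),\qquad p\colon k^G\to kH,\; p(a)=(\mathrm{ev}_{1}\otimes\mathrm{id})\psi(a\#1),$$ $$r\colon kG\to k^H,\; r(x)=(\mathrm{id}\otimes\varepsilon_{kH})\psi(\varepsilon\#x),\qquad v\colon kG\to kH,\; v(x)=(\mathrm{ev}_{1}\otimes\mathrm{id})\psi(\varepsilon\#x),$$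 where $\varepsilon_{kH}$ is the counit of $kH$ and $\mathrm{ev}_1\colon k^H\to k$ is evaluation at $1\in H$; we write $\psi=(p,u,r,v)$. Let $f^*$ denote the linear dual of a linear map $f$, where $(kG)^*=k^G$ and $(k^G)^*=kG$, and likewise for $H$. The morphism $\psi=(p,u,r,v)$ is called flippable if there is a morphism of Hopf algebras $D(H)\to D(G)$ with components $(p^*,v^*,r^*,u^*)$; this morphism is then called the flip of $\psi$. Let $G$ be a finite group, and let $\mathrm{Aut}(D(G))$ be the group of Hopf algebra automorphisms of $D(G)$ under composition. Then every $\psi\in\mathrm{Aut}(D(G))$ is flippable. Moreover, every flip of an automorphism is itself an automorphism, the flip of an automorphism is unique, and the map sending $\psi$ to its flip is an anti-isomorphism of the group $\mathrm{Aut}(D(G))$, i.e. a bijection $F\colon \mathrm{Aut}(D(G))\to\mathrm{Aut}(D(G))$ with $F(\phi\circ\psi)=F(\psi)\circ F(\phi)$. -/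

import Mathlib

open scoped TensorProduct

noncomputable section

namespace DrinfeldDouble

/-- The underlying vector space of the Drinfeld double `D(G) = (k^G)^cop # kG` of a finite
group `G`: the free module on the symbols `e_g # h`, `g, h ∈ G`. -/
def _root_.DrinfeldDouble (k G : Type*) [Field k] : Type _ := (G × G) →₀ k

section Structure

variable {k G : Type*} [Field k]

instance : AddCommGroup (DrinfeldDouble k G) := inferInstanceAs (AddCommGroup ((G × G) →₀ k))

instance : Module k (DrinfeldDouble k G) := inferInstanceAs (Module k ((G × G) →₀ k))

variable (k G) in
/-- The standard basis `(g, h) ↦ e_g # h` of `D(G)`. -/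
def basis : Module.Basis (G × G) k (DrinfeldDouble k G) :=
  (Finsupp.basisSingleOne : Module.Basis (G × G) k ((G × G) →₀ k))

variable (k) in
/-- The element `e_g # h` of `D(G)`. -/
def e (g h : G) : DrinfeldDouble k G := basis k G (g, h)

/-- The linear map on `D(G)` with prescribed values on the elements `e_g # h`. -/
def lin {M : Type*} [AddCommGroup M] [Module k M] (f : G → G → M) : DrinfeldDouble k G →ₗ[k] M :=
  (basis k G).constr k (fun x => f x.1 x.2)

theorem lin_e {M : Type*} [AddCommGroup M] [Module k M] (f : G → G → M) (g h : G) :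
    lin f (e k g h) = f g h := by
  simp [lin, e, Module.Basis.constr_basis]

theorem hom_ext {M : Type*} [AddCommGroup M] [Module k M] {f f' : DrinfeldDouble k G →ₗ[k] M}
    (h : ∀ x y, f (e k x y) = f' (e k x y)) : f = f' :=
  (basis k G).ext (fun x => h x.1 x.2)

section One

variable [Group G] [Fintype G]

/-- The identity `ε # 1`, where `ε = ∑_g e_g`. -/
instance : One (DrinfeldDouble k G) := ⟨∑ g : G, e k g 1⟩

theorem one_def : (1 : DrinfeldDouble k G) = ∑ g : G, e k g 1 := rfl

end One

variable [Group G] [DecidableEq G]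

/-- The multiplication `(e_g # g') (e_h # h') = δ_{g, g' h g'⁻¹} e_g # g' h'`. -/
def mulMap : DrinfeldDouble k G →ₗ[k] DrinfeldDouble k G →ₗ[k] DrinfeldDouble k G :=
  lin fun g g' => lin fun h h' => if g = g' * h * g'⁻¹ then e k g (g' * h') else 0

theorem mulMap_e (g g' h h' : G) :
    mulMap (e k g g') (e k h h') = if g = g' * h * g'⁻¹ then e k g (g' * h') else 0 := by
  simp [mulMap, lin_e]

instance : Mul (DrinfeldDouble k G) := ⟨fun x y => mulMap x y⟩

theorem mul_def (x y : DrinfeldDouble k G) : x * y = mulMap x y := rfl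

theorem e_mul_e (g g' h h' : G) :
    e k g g' * e k h h' = if g = g' * h * g'⁻¹ then e k g (g' * h') else 0 := mulMap_e _ _ _ _

theorem mulMap_assoc (x y z : DrinfeldDouble k G) :
    mulMap (mulMap x y) z = mulMap x (mulMap y z) := by
  suffices H : ∀ a b c d f g : G, mulMap (mulMap (e k a b) (e k c d)) (e k f g)
      = mulMap (e k a b) (mulMap (e k c d) (e k f g)) by
    have H3 : ∀ a b c d : G, mulMap (mulMap (e k a b) (e k c d))
        = mulMap (e k a b) ∘ₗ mulMap (e k c d) :=
      fun a b c d => hom_ext fun f g => H a b c d f g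
    have H2 : ∀ a b : G, mulMap.flip z ∘ₗ mulMap (e k a b) = mulMap (e k a b) ∘ₗ mulMap.flip z :=
      fun a b => hom_ext fun c d => LinearMap.congr_fun (H3 a b c d) z
    have H1 : mulMap.flip z ∘ₗ mulMap.flip y = mulMap.flip (mulMap y z) :=
      hom_ext fun a b => LinearMap.congr_fun (H2 a b) y
    exact LinearMap.congr_fun H1 x
  intro a b c d f g
  simp only [mulMap_e]
  by_cases h1 : a = b * c * b⁻¹
  · have h2 : a = b * d * f * (b * d)⁻¹ ↔ c = d * f * d⁻¹ := by
      have : b * d * f * (b * d)⁻¹ = b * (d * f * d⁻¹) * b⁻¹ := by group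
      rw [h1, this, mul_left_inj, mul_right_inj]
    rw [if_pos h1, mulMap_e]
    simp only [h2, mul_assoc b d g]
    split_ifs
    · rw [mulMap_e, if_pos h1]
    · simp
  · rw [if_neg h1]
    split_ifs
    · simp [mulMap_e, h1]
    · simp

variable [Fintype G]

instance : Ring (DrinfeldDouble k G) where
  __ := (inferInstance : AddCommGroup (DrinfeldDouble k G))
  left_distrib x y z := by simp [mul_def]
  right_distrib x y z := by simp [mul_def]
  zero_mul x := by simp [mul_def]
  mul_zero x := by simp [mul_def]
  mul_assoc := mulMap_assoc
  one_mul x := by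
    have H : mulMap (1 : DrinfeldDouble k G) = LinearMap.id := by
      refine hom_ext fun g h => ?_
      simp [one_def, mulMap_e]
    exact LinearMap.congr_fun H x
  mul_one x := by
    have H : mulMap.flip (1 : DrinfeldDouble k G) = LinearMap.id := by
      refine hom_ext fun g h => ?_
      have : ∀ x : G, g = h * x * h⁻¹ ↔ h⁻¹ * g * h = x := fun x => by
        constructor <;> rintro rfl <;> group
      simp [one_def, mulMap_e, this]
    exact LinearMap.congr_fun H x

instance : Algebra k (DrinfeldDouble k G) :=
  Algebra.ofModule (fun r x y => by simp [mul_def]) (fun r x y => by simp [mul_def])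

/-- The coalgebra structure of `(k^G)^cop ⊗ kG`:
`Δ (e_g # h) = ∑_{ba = g} (e_a # h) ⊗ (e_b # h)` and `ε (e_g # h) = δ_{g,1}`. -/
instance : CoalgebraStruct k (DrinfeldDouble k G) where
  comul := lin fun g h => ∑ a : G, e k a h ⊗ₜ[k] e k (g * a⁻¹) h
  counit := lin fun g _ => if g = 1 then 1 else 0

theorem comul_e (g h : G) :
    Coalgebra.comul (R := k) (e k g h) = ∑ a : G, e k a h ⊗ₜ[k] e k (g * a⁻¹) h := lin_e _ _ _

theorem counit_e (g h : G) :
    Coalgebra.counit (R := k) (e k g h) = if g = 1 then 1 else 0 := lin_e _ _ _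

instance : Coalgebra k (DrinfeldDouble k G) where
  coassoc := by
    refine hom_ext fun g h => ?_
    simp only [LinearMap.coe_comp, Function.comp_apply, comul_e, map_sum,
      LinearMap.rTensor_tmul, LinearMap.lTensor_tmul, LinearEquiv.coe_coe, TensorProduct.sum_tmul,
      TensorProduct.tmul_sum, TensorProduct.assoc_tmul]
    rw [Finset.sum_comm]
    refine Finset.sum_congr rfl fun a _ => ?_
    refine Fintype.sum_equiv (Equiv.mulRight a⁻¹) _ _ fun b => ?_
    simp [mul_assoc]
  rTensor_counit_comp_comul := by
    refine hom_ext fun g h => ?_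
    simp [comul_e, counit_e, TensorProduct.ite_tmul]
  lTensor_counit_comp_comul := by
    refine hom_ext fun g h => ?_
    simp [comul_e, counit_e, TensorProduct.tmul_ite, mul_inv_eq_one]

instance : Bialgebra k (DrinfeldDouble k G) :=
  Bialgebra.mk' k (DrinfeldDouble k G)
    (by simp [one_def, counit_e])
    (by
      intro x y
      have H : (mulMap (k := k) (G := G)).compr₂ Coalgebra.counit
          = (LinearMap.mul k k).compl₁₂ Coalgebra.counit Coalgebra.counit := by
        refine hom_ext fun a b => hom_ext fun c d => ?_
        simp only [LinearMap.compr₂_apply, mulMap_e, LinearMap.compl₁₂_apply, counit_e,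
          LinearMap.mul_apply']
        by_cases hc : c = 1
        · subst hc
          by_cases ha : a = 1 <;> simp [ha, counit_e]
        · by_cases ha : a = 1
          · have : ¬ (1 : G) = b * c * b⁻¹ := by
              intro h; apply hc; simpa [eq_comm, mul_inv_eq_one] using h
            simp [ha, hc, this]
          · split_ifs <;> simp [ha, counit_e]
      exact LinearMap.congr_fun (LinearMap.congr_fun H x) y)
    (by
      simp only [one_def, map_sum, comul_e, Algebra.TensorProduct.one_def, TensorProduct.sum_tmul,
        TensorProduct.tmul_sum]
      conv_lhs => rw [Finset.sum_comm]
      conv_rhs => rw [Finset.sum_comm]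
      refine Finset.sum_congr rfl fun a _ => ?_
      exact Fintype.sum_equiv (Equiv.mulRight a⁻¹) _ _ fun b => by simp)
    (by
      intro x y
      have H : (mulMap (k := k) (G := G)).compr₂ Coalgebra.comul
          = (LinearMap.mul k (DrinfeldDouble k G ⊗[k] DrinfeldDouble k G)).compl₁₂
              Coalgebra.comul Coalgebra.comul := by
        refine hom_ext fun a b => hom_ext fun c d => ?_
        simp only [LinearMap.compr₂_apply, mulMap_e, LinearMap.compl₁₂_apply, comul_e,
          LinearMap.mul_apply', Finset.sum_mul_sum, Algebra.TensorProduct.tmul_mul_tmul, e_mul_e]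
        have key : ∀ x : G, ∑ y : G,
            (if x = b * y * b⁻¹ then e k x (b * d) else 0) ⊗ₜ[k]
              (if a * x⁻¹ = b * (c * y⁻¹) * b⁻¹ then e k (a * x⁻¹) (b * d) else 0)
            = if a = b * c * b⁻¹ then e k x (b * d) ⊗ₜ[k] e k (a * x⁻¹) (b * d) else 0 := by
          intro x
          rw [Finset.sum_eq_single (b⁻¹ * x * b)]
          · have h1 : x = b * (b⁻¹ * x * b) * b⁻¹ := by group
            rw [if_pos h1]
            have h2 : a * x⁻¹ = b * (c * (b⁻¹ * x * b)⁻¹) * b⁻¹ ↔ a = b * c * b⁻¹ := by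
              have : b * (c * (b⁻¹ * x * b)⁻¹) * b⁻¹ = (b * c * b⁻¹) * x⁻¹ := by group
              rw [this, mul_left_inj]
            simp only [h2]
            split_ifs <;> simp
          · intro y _ hy
            have : ¬ x = b * y * b⁻¹ := by
              rintro rfl; apply hy; group
            simp [this]
          · simp
        simp only [key]
        split_ifs <;> simp [comul_e]
      exact LinearMap.congr_fun (LinearMap.congr_fun H x) y)

/-- The antipode is `S (e_g # h) = e_{h⁻¹ g⁻¹ h} # h⁻¹`. -/
instance : HopfAlgebra k (DrinfeldDouble k G) where
  antipode := lin fun g h => e k (h⁻¹ * g⁻¹ * h) h⁻¹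
  mul_antipode_rTensor_comul := by
    refine hom_ext fun g h => ?_
    simp only [LinearMap.coe_comp, Function.comp_apply, comul_e, map_sum, LinearMap.rTensor_tmul,
      lin_e, LinearMap.mul'_apply, e_mul_e, counit_e, Algebra.linearMap_apply]
    have : ∀ a : G, h⁻¹ * a⁻¹ * h = h⁻¹ * (g * a⁻¹) * h⁻¹⁻¹ ↔ g = 1 := by
      intro a
      rw [inv_inv, mul_left_inj, mul_right_inj, eq_comm, mul_eq_right]
    simp only [this]
    split_ifs
    · simp only [inv_mul_cancel, map_one, one_def]
      exact Fintype.sum_equiv ((Equiv.inv G).trans (MulAut.conj h⁻¹).toEquiv) _ _ fun b => by simp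
    · simp
  mul_antipode_lTensor_comul := by
    refine hom_ext fun g h => ?_
    simp only [LinearMap.coe_comp, Function.comp_apply, comul_e, map_sum, LinearMap.lTensor_tmul,
      lin_e, LinearMap.mul'_apply, e_mul_e, counit_e, Algebra.linearMap_apply]
    have : ∀ a : G, a = h * (h⁻¹ * (g * a⁻¹)⁻¹ * h) * h⁻¹ ↔ g = 1 := by
      intro a
      have : h * (h⁻¹ * (g * a⁻¹)⁻¹ * h) * h⁻¹ = a * g⁻¹ := by group
      rw [this, eq_comm, mul_eq_left, inv_eq_one]
    simp only [this]
    split_ifs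
    · simp [one_def]
    · simp

end Structure

section Components

variable {k G H : Type*} [Field k] [Group G] [Fintype G] [DecidableEq G]
  [Group H] [Fintype H] [DecidableEq H]

variable (k G) in
/-- `a ↦ a # 1`, from `k^G` to `D(G)`; here `k^G` is realised as the functions `G → k`, the
basis vector `e_g` being the indicator function of `g`. -/
def inclFun : (G → k) →ₗ[k] DrinfeldDouble k G :=
  (Pi.basisFun k G).constr k (fun g => e k g 1)

variable (k G) in
/-- `x ↦ ε # x`, from `kG` to `D(G)`. -/
def inclGrp : MonoidAlgebra k G →ₗ[k] DrinfeldDouble k G :=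
  (MonoidAlgebra.basis G k).constr k (fun h => ∑ g : G, e k g h)

variable (k G) in
/-- `id ⊗ ε : D(G) → k^G`. -/
def projFun : DrinfeldDouble k G →ₗ[k] (G → k) :=
  lin fun g _ => Pi.single g 1

variable (k G) in
/-- `ev_1 ⊗ id : D(G) → kG`. -/
def projGrp : DrinfeldDouble k G →ₗ[k] MonoidAlgebra k G :=
  lin fun g h => if g = 1 then MonoidAlgebra.single h 1 else 0

/-- The component `p : k^G → kH` of a morphism `ψ = (p, u, r, v) : D(G) → D(H)`,
`p a = (ev_1 ⊗ id) (ψ (a # 1))`. -/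
def compP (ψ : DrinfeldDouble k G →ₐc[k] DrinfeldDouble k H) : (G → k) →ₗ[k] MonoidAlgebra k H :=
  projGrp k H ∘ₗ (ψ : DrinfeldDouble k G →ₗ[k] DrinfeldDouble k H) ∘ₗ inclFun k G

/-- The component `u : k^G → k^H`, `u a = (id ⊗ ε) (ψ (a # 1))`. -/
def compU (ψ : DrinfeldDouble k G →ₐc[k] DrinfeldDouble k H) : (G → k) →ₗ[k] (H → k) :=
  projFun k H ∘ₗ (ψ : DrinfeldDouble k G →ₗ[k] DrinfeldDouble k H) ∘ₗ inclFun k G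

/-- The component `r : kG → k^H`, `r x = (id ⊗ ε) (ψ (ε # x))`. -/
def compR (ψ : DrinfeldDouble k G →ₐc[k] DrinfeldDouble k H) : MonoidAlgebra k G →ₗ[k] (H → k) :=
  projFun k H ∘ₗ (ψ : DrinfeldDouble k G →ₗ[k] DrinfeldDouble k H) ∘ₗ inclGrp k G

/-- The component `v : kG → kH`, `v x = (ev_1 ⊗ id) (ψ (ε # x))`. -/
def compV (ψ : DrinfeldDouble k G →ₐc[k] DrinfeldDouble k H) :
    MonoidAlgebra k G →ₗ[k] MonoidAlgebra k H :=
  projGrp k H ∘ₗ (ψ : DrinfeldDouble k G →ₗ[k] DrinfeldDouble k H) ∘ₗ inclGrp k G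

variable (k G) in
/-- The identification of `k^G` with the linear dual of `kG`, `f ↦ (g ↦ f g)`. -/
def funEquivDual : (G → k) ≃ₗ[k] Module.Dual k (MonoidAlgebra k G) :=
  (MonoidAlgebra.basis G k).constr k

variable (k G) in
/-- The identification of `kG` with the linear dual of `k^G`, `g ↦ (f ↦ f g)`. -/
def grpEquivDual : MonoidAlgebra k G ≃ₗ[k] Module.Dual k (G → k) :=
  (MonoidAlgebra.basis G k).equivFun ≪≫ₗ (Pi.basisFun k G).constr k

/-- The linear dual `f^* : N' → M'` of `f : M → N`, where `M'` and `N'` are identified with the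
linear duals of `M` and `N`. -/
def dual {M N M' N' : Type*} [AddCommGroup M] [Module k M] [AddCommGroup N] [Module k N]
    [AddCommGroup M'] [Module k M'] [AddCommGroup N'] [Module k N']
    (eM : M' ≃ₗ[k] Module.Dual k M) (eN : N' ≃ₗ[k] Module.Dual k N) (f : M →ₗ[k] N) :
    N' →ₗ[k] M' :=
  eM.symm.toLinearMap ∘ₗ f.dualMap ∘ₗ eN.toLinearMap

/-- `φ : D(H) → D(G)` is the morphism of Hopf algebras with components `(p^*, v^*, r^*, u^*)`, where
`ψ = (p, u, r, v) : D(G) → D(H)`. -/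
structure IsFlip (ψ : DrinfeldDouble k G →ₐc[k] DrinfeldDouble k H)
    (φ : DrinfeldDouble k H →ₐc[k] DrinfeldDouble k G) : Prop where
  p_eq : compP φ = dual (grpEquivDual k G) (funEquivDual k H) (compP ψ)
  u_eq : compU φ = dual (funEquivDual k G) (funEquivDual k H) (compV ψ)
  r_eq : compR φ = dual (funEquivDual k G) (grpEquivDual k H) (compR ψ)
  v_eq : compV φ = dual (grpEquivDual k G) (grpEquivDual k H) (compU ψ)

/-- `ψ = (p, u, r, v)` is flippable if `(p^*, v^*, r^*, u^*)` is a morphism of Hopf algebras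
`D(H) → D(G)`. -/
def IsFlippable (ψ : DrinfeldDouble k G →ₐc[k] DrinfeldDouble k H) : Prop :=
  ∃ φ : DrinfeldDouble k H →ₐc[k] DrinfeldDouble k G, IsFlip ψ φ

end Components

/-- The automorphism group of a bialgebra (for a Hopf algebra: its Hopf automorphisms, since
bialgebra maps preserve antipodes) under composition. -/
instance autGroup {R A : Type*} [CommSemiring R] [Semiring A] [Bialgebra R A] :
    Group (A ≃ₐc[R] A) where
  mul f g := g.trans f
  one := BialgEquiv.refl R A
  inv f := f.symm
  mul_assoc _ _ _ := rfl
  one_mul _ := rfl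
  mul_one _ := rfl
  inv_mul_cancel f := DFunLike.ext _ _ f.symm_apply_apply

end DrinfeldDouble

end

/-! Pair `D(G)` with itself by declaring `e_g # x` dual to `e_x # g`. For these pairings the flip of
`ψ` is its adjoint: the transposed matrix with the factors `k^G` and `kG` exchanged
(`IsAdjoint.isFlip`). Adjoints are unique, involutive and reverse composition, and a morphism is
determined by its four components (`hom_ext_of_components`). So everything reduces to one point: the
adjoint of a bijective `ψ`, a priori only a linear map, is again a morphism of Hopf algebras.

This follows from a description of `ψ` that is symmetric in `G` and `H`. Bijectivity forces the
matrix of `p` to be supported on `Z(G) × Z(H)`. Then `u` is dual to a homomorphism `w : H → G`, `v`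
comes from a homomorphism `G → H`, `r` is a bicharacter, and `v`, `w` are mutually inverse modulo
centers. The coefficient of `e_h # y` in `ψ(e_g # x)` becomes `p(g w(h)⁻¹, y v(x)⁻¹) r(x, h)`
(`exists_eq_toBialgHom`). Conversely, any such data define a morphism (`CentralData.toBialgHom`).
The conditions are unchanged when `G` and `H`, `v` and `w` trade places, and the exchanged data give
the adjoint.

Centrality of the support comes from commutation: injectivity makes certain rows of the matrix of
`ψ` span `kG`, and surjectivity makes the images of `p` and `v` generate `kH`. -/

noncomputable section

set_option linter.unusedSectionVars false

namespace DrinfeldDouble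

/-! ### Matrix coefficients of morphisms, their components and linear duals. -/

section Coordinates

variable {k G H : Type*} [Field k]

variable (k) in
/-- The coefficient of `e_g # h` in an element of `D(G)`. -/
def coord (g h : G) : DrinfeldDouble k G →ₗ[k] k := (basis k G).coord (g, h)

theorem coord_e [DecidableEq G] (g h g' h' : G) :
    coord k g h (e k g' h') = if g' = g ∧ h' = h then 1 else 0 := by
  simp [coord, e, Finsupp.single_apply]

theorem ext_coord {z z' : DrinfeldDouble k G} (h : ∀ x y, coord k x y z = coord k x y z') :
    z = z' :=
  (basis k G).ext_elem fun i => h i.1 i.2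

theorem sum_coord_smul_e [Fintype G] (z : DrinfeldDouble k G) :
    ∑ x, ∑ y, coord k x y z • e k x y = z := by
  rw [← Fintype.sum_prod_type']
  exact (basis k G).sum_repr z

variable (k) in
/-- The element `ε # x` of `D(G)`. -/
def grp [Fintype G] (x : G) : DrinfeldDouble k G := ∑ g : G, e k g x

theorem coord_sum_e [Fintype G] [DecidableEq G] (c : G → k) (g h y : G) :
    coord k g h (∑ a, c a • e k a y) = if y = h then c g else 0 := by
  simp [coord_e, ite_and]

theorem coord_grp [Fintype G] [DecidableEq G] (g h x : G) :
    coord k g h (grp k x) = if x = h then 1 else 0 := by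
  simp [grp, coord_e, ite_and]

variable [Group G] [Fintype G] [DecidableEq G] [Group H] [Fintype H] [DecidableEq H]

theorem grp_one : grp k (1 : G) = 1 := rfl

theorem e_one_mul_grp (g x : G) : e k g 1 * grp k x = e k g x := by
  simp [grp, Finset.mul_sum, e_mul_e]

theorem e_mul_grp (g x y : G) : e k g x * grp k y = e k g (x * y) := by
  simp only [grp, Finset.mul_sum, e_mul_e]
  rw [Finset.sum_eq_single (x⁻¹ * g * x)]
  · rw [if_pos (by group)]
  · intro b _ hb
    rw [if_neg]
    rintro rfl
    exact hb (by group)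
  · simp

theorem grp_mul_e (x g : G) : grp k x * e k g 1 = e k (x * g * x⁻¹) x := by
  simp [grp, Finset.sum_mul, e_mul_e]

theorem grp_mul_e_one (x g : G) : grp k x * e k g 1 = e k (x * g * x⁻¹) 1 * grp k x := by
  rw [grp_mul_e, e_one_mul_grp]

theorem grp_mul_grp (x y : G) : grp k x * grp k y = grp k (x * y) := by
  rw [grp, Finset.sum_mul, grp]
  exact Finset.sum_congr rfl fun g _ => e_mul_grp g x y

/-- Coefficients of a comultiplication. -/
theorem mul_coord_comul (h y h' y' : G) (z : DrinfeldDouble k G) :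
    LinearMap.mul' k k (TensorProduct.map (coord k h y) (coord k h' y') (Coalgebra.comul z))
      = if y = y' then coord k (h' * h) y z else 0 := by
  have H : LinearMap.mul' k k ∘ₗ TensorProduct.map (coord k h y) (coord k h' y') ∘ₗ
      Coalgebra.comul = if y = y' then coord k (h' * h) y else 0 := by
    refine hom_ext fun g x => ?_
    by_cases hy : y = y'
    · subst hy
      by_cases hx : x = y
      · subst hx
        simp only [LinearMap.coe_comp, Function.comp_apply, comul_e, map_sum,
          TensorProduct.map_tmul, coord_e, and_true, LinearMap.mul'_apply, if_true]
        rw [Finset.sum_eq_single h] <;> simp +contextual [mul_inv_eq_iff_eq_mul]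
      · simp [comul_e, coord_e, hx]
    · by_cases hx : x = y
      · subst hx
        simp [comul_e, coord_e, hy]
      · simp [comul_e, coord_e, hx, hy]
  have := LinearMap.congr_fun H z
  split_ifs at this ⊢ <;> simpa using this

theorem tensor_ext_coord {t t' : DrinfeldDouble k G ⊗[k] DrinfeldDouble k G}
    (h : ∀ x y x' y', LinearMap.mul' k k (TensorProduct.map (coord k x y) (coord k x' y') t)
      = LinearMap.mul' k k (TensorProduct.map (coord k x y) (coord k x' y') t')) : t = t' := by
  refine ((basis k G).tensorProduct (basis k G)).ext_elem fun i => ?_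
  have H : ∀ t, ((basis k G).tensorProduct (basis k G)).repr t i = LinearMap.mul' k k
      (TensorProduct.map (coord k i.1.1 i.1.2) (coord k i.2.1 i.2.2) t) := fun t => by
    induction t with
    | zero => simp
    | tmul a b =>
      obtain ⟨i, j⟩ := i
      rw [Module.Basis.tensorProduct_repr_tmul_apply]
      simp [coord, mul_comm]
    | add a b ha hb => simp only [map_add, Finsupp.add_apply, ha, hb]
  rw [H, H, h]

theorem counit_eq_sum_coord (z : DrinfeldDouble k G) :
    Coalgebra.counit (R := k) z = ∑ y, coord k 1 y z := by
  have H : (Coalgebra.counit : DrinfeldDouble k G →ₗ[k] k) = ∑ y, coord k 1 y :=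
    hom_ext fun g x => by simp [counit_e, coord_e, ite_and]
  simpa using LinearMap.congr_fun H z

theorem coeff_projGrp (z : DrinfeldDouble k G) (y : G) :
    (projGrp k G z).coeff y = coord k 1 y z := by
  conv_lhs => rw [← sum_coord_smul_e z]
  simp only [map_sum, map_smul, projGrp, lin_e, MonoidAlgebra.coeff_sum, MonoidAlgebra.coeff_smul,
    Finsupp.finsetSum_apply, Finsupp.smul_apply]
  rw [Finset.sum_eq_single 1]
  · simp [Finsupp.single_apply]
  · intro b _ hb
    simp [hb]
  · simp

theorem projFun_apply (z : DrinfeldDouble k G) (h : G) :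
    projFun k G z h = ∑ y, coord k h y z := by
  conv_lhs => rw [← sum_coord_smul_e z]
  simp [map_sum, projFun, lin_e, Pi.single_apply]

theorem inclFun_single (g : G) : inclFun k G (Pi.single g 1) = e k g 1 := by
  simp [inclFun]

theorem inclGrp_single (x : G) : inclGrp k G (MonoidAlgebra.single x 1) = grp k x := by
  have := (MonoidAlgebra.basis G k).constr_basis k (fun x => grp k x) x
  rwa [MonoidAlgebra.basis_apply] at this

section Components

variable (ψ : DrinfeldDouble k G →ₐc[k] DrinfeldDouble k H)

theorem coeff_compP (g : G) (y : H) :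
    (compP ψ (Pi.single g 1)).coeff y = coord k 1 y (ψ (e k g 1)) := by
  simp [compP, coeff_projGrp, inclFun_single]

theorem compU_apply (g : G) (h : H) :
    compU ψ (Pi.single g 1) h = ∑ y, coord k h y (ψ (e k g 1)) := by
  simp [compU, projFun_apply, inclFun_single]

theorem compR_apply (x : G) (h : H) :
    compR ψ (MonoidAlgebra.single x 1) h = ∑ y, coord k h y (ψ (grp k x)) := by
  simp [compR, projFun_apply, inclGrp_single]

theorem coeff_compV (x : G) (y : H) :
    (compV ψ (MonoidAlgebra.single x 1)).coeff y = coord k 1 y (ψ (grp k x)) := by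
  simp [compV, coeff_projGrp, inclGrp_single]

end Components

theorem funEquivDual_apply (a : G → k) (x : G) :
    funEquivDual k G a (MonoidAlgebra.single x 1) = a x := by
  have := (MonoidAlgebra.basis G k).constr_basis k a x
  rwa [MonoidAlgebra.basis_apply] at this

theorem grpEquivDual_apply (c : MonoidAlgebra k G) (g : G) :
    grpEquivDual k G c (Pi.single g 1) = c.coeff g := by
  have := (Pi.basisFun k G).constr_basis k (MonoidAlgebra.basis G k |>.equivFun c) g
  simp only [Pi.basisFun_apply] at this
  exact this

theorem apply_dual {M N M' N' : Type*} [AddCommGroup M] [Module k M] [AddCommGroup N] [Module k N]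
    [AddCommGroup M'] [Module k M'] [AddCommGroup N'] [Module k N']
    (eM : M' ≃ₗ[k] Module.Dual k M) (eN : N' ≃ₗ[k] Module.Dual k N) (f : M →ₗ[k] N) (n : N')
    (m : M) : eM (dual eM eN f n) m = eN n (f m) := by
  simp [dual]

theorem funEquivDual_single (g : G) (c : MonoidAlgebra k G) :
    funEquivDual k G (Pi.single g 1) c = c.coeff g := by
  have : funEquivDual k G (Pi.single g 1) = (MonoidAlgebra.basis G k).coord g := by
    refine (MonoidAlgebra.basis G k).ext fun x => ?_
    rw [MonoidAlgebra.basis_apply, funEquivDual_apply, ← MonoidAlgebra.basis_apply]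
    simp [-MonoidAlgebra.basis_apply, Pi.single_apply, Finsupp.single_apply]
  rw [this]
  rfl

theorem grpEquivDual_single (x : G) (a : G → k) :
    grpEquivDual k G (MonoidAlgebra.single x 1) a = a x := by
  have : grpEquivDual k G (MonoidAlgebra.single x 1) = LinearMap.proj x := by
    refine (Pi.basisFun k G).ext fun g => ?_
    rw [Pi.basisFun_apply, grpEquivDual_apply]
    simp [Pi.single_apply, Finsupp.single_apply]
  rw [this]
  rfl

theorem linearMap_fun_ext {M : Type*} [AddCommGroup M] [Module k M] {f f' : (G → k) →ₗ[k] M}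
    (h : ∀ g, f (Pi.single g 1) = f' (Pi.single g 1)) : f = f' :=
  (Pi.basisFun k G).ext fun g => by simpa using h g

theorem linearMap_grp_ext {M : Type*} [AddCommGroup M] [Module k M]
    {f f' : MonoidAlgebra k G →ₗ[k] M}
    (h : ∀ x, f (MonoidAlgebra.single x 1) = f' (MonoidAlgebra.single x 1)) : f = f' :=
  (MonoidAlgebra.basis G k).ext fun g => by simpa [MonoidAlgebra.basis_apply] using h g

section Dual

theorem coeff_dual_p (f : (G → k) →ₗ[k] MonoidAlgebra k H) (h : H) (g : G) :
    (dual (grpEquivDual k G) (funEquivDual k H) f (Pi.single h 1)).coeff g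
      = (f (Pi.single g 1)).coeff h := by
  rw [← grpEquivDual_apply, apply_dual, funEquivDual_single]

theorem dual_u_apply (f : MonoidAlgebra k G →ₗ[k] MonoidAlgebra k H) (h : H) (g : G) :
    dual (funEquivDual k G) (funEquivDual k H) f (Pi.single h 1) g
      = (f (MonoidAlgebra.single g 1)).coeff h := by
  rw [← funEquivDual_apply (k := k) (dual _ _ _ _), apply_dual, funEquivDual_single]

theorem dual_r_apply (f : MonoidAlgebra k G →ₗ[k] (H → k)) (h : H) (g : G) :
    dual (funEquivDual k G) (grpEquivDual k H) f (MonoidAlgebra.single h 1) g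
      = f (MonoidAlgebra.single g 1) h := by
  rw [← funEquivDual_apply (k := k) (dual _ _ _ _), apply_dual, grpEquivDual_single]

theorem coeff_dual_v (f : (G → k) →ₗ[k] (H → k)) (h : H) (g : G) :
    (dual (grpEquivDual k G) (grpEquivDual k H) f (MonoidAlgebra.single h 1)).coeff g
      = f (Pi.single g 1) h := by
  rw [← grpEquivDual_apply, apply_dual, grpEquivDual_single]

end Dual

/-! ### Adjoint morphisms. -/

/-- A morphism `φ` is the adjoint of `ψ` if its matrix is that of `ψ`, transposed, with the
two factors of `k^G ⊗ kG` and of `k^H ⊗ kH` swapped. -/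
def IsAdjoint (ψ : DrinfeldDouble k G →ₐc[k] DrinfeldDouble k H)
    (φ : DrinfeldDouble k H →ₐc[k] DrinfeldDouble k G) : Prop :=
  ∀ (g x : G) (h y : H), coord k g x (φ (e k h y)) = coord k y h (ψ (e k x g))

theorem IsAdjoint.symm {ψ : DrinfeldDouble k G →ₐc[k] DrinfeldDouble k H}
    {φ : DrinfeldDouble k H →ₐc[k] DrinfeldDouble k G} (h : IsAdjoint ψ φ) : IsAdjoint φ ψ :=
  fun _ _ _ _ => (h _ _ _ _).symm

theorem IsAdjoint.unique {ψ : DrinfeldDouble k G →ₐc[k] DrinfeldDouble k H}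
    {φ φ' : DrinfeldDouble k H →ₐc[k] DrinfeldDouble k G} (h : IsAdjoint ψ φ)
    (h' : IsAdjoint ψ φ') : φ = φ' := by
  have : (φ : DrinfeldDouble k H →ₗ[k] DrinfeldDouble k G) = φ' :=
    hom_ext fun a b => ext_coord fun x y => (h _ _ _ _).trans (h' _ _ _ _).symm
  exact DFunLike.ext _ _ fun z => LinearMap.congr_fun this z

theorem IsAdjoint.id : IsAdjoint (BialgHom.id k (DrinfeldDouble k G)) (BialgHom.id k _) := by
  intro g x h y
  simp only [BialgHom.id_apply, coord_e]
  congr 1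
  simp only [eq_iff_iff]
  tauto

theorem coord_map {K : Type*} [Group K] [Fintype K] [DecidableEq K]
    (ψ : DrinfeldDouble k G →ₐc[k] DrinfeldDouble k K) (z : DrinfeldDouble k G) (h y : K) :
    coord k h y (ψ z) = ∑ a, ∑ b, coord k a b z * coord k h y (ψ (e k a b)) := by
  conv_lhs => rw [← sum_coord_smul_e z]
  simp

theorem IsAdjoint.comp {K : Type*} [Group K] [Fintype K] [DecidableEq K]
    {ψ : DrinfeldDouble k G →ₐc[k] DrinfeldDouble k H}
    {φ : DrinfeldDouble k H →ₐc[k] DrinfeldDouble k G}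
    {ψ' : DrinfeldDouble k H →ₐc[k] DrinfeldDouble k K}
    {φ' : DrinfeldDouble k K →ₐc[k] DrinfeldDouble k H}
    (h : IsAdjoint ψ φ) (h' : IsAdjoint ψ' φ') : IsAdjoint (ψ'.comp ψ) (φ.comp φ') := by
  intro g x a b
  simp only [BialgHom.comp_apply]
  rw [coord_map, coord_map, Finset.sum_comm]
  refine Finset.sum_congr rfl fun c _ => Finset.sum_congr rfl fun d _ => ?_
  rw [h, h', mul_comm]

theorem coord_map_grp (ψ : DrinfeldDouble k G →ₐc[k] DrinfeldDouble k H) (x : G) (h y : H) :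
    coord k h y (ψ (grp k x)) = ∑ g, coord k h y (ψ (e k g x)) := by
  simp [grp]

/-- Each component is read off the matrix by setting some indices to `1` and summing over others.
The index swap exchanges the recipes for `u` and `v` and preserves those for `p` and `r`. -/
theorem IsAdjoint.isFlip {ψ : DrinfeldDouble k G →ₐc[k] DrinfeldDouble k H}
    {φ : DrinfeldDouble k H →ₐc[k] DrinfeldDouble k G} (h : IsAdjoint ψ φ) : IsFlip ψ φ where
  p_eq := linearMap_fun_ext fun a => MonoidAlgebra.ext (Finsupp.ext fun g => by
    rw [coeff_dual_p, coeff_compP, coeff_compP, h])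
  u_eq := linearMap_fun_ext fun a => funext fun g => by
    rw [dual_u_apply, compU_apply, coeff_compV, coord_map_grp]
    exact Finset.sum_congr rfl fun _ _ => h _ _ _ _
  r_eq := linearMap_grp_ext fun a => funext fun g => by
    simp only [dual_r_apply, compR_apply, coord_map_grp]
    rw [Finset.sum_comm]
    conv_rhs => rw [Finset.sum_comm]
    rw [Finset.sum_comm]
    exact Finset.sum_congr rfl fun _ _ => Finset.sum_congr rfl fun _ _ => h _ _ _ _
  v_eq := linearMap_grp_ext fun a => MonoidAlgebra.ext (Finsupp.ext fun g => by
    rw [coeff_dual_v, coeff_compV, compU_apply, coord_map_grp]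
    exact Finset.sum_congr rfl fun _ _ => h _ _ _ _)

/-! ### A morphism is determined by its components. -/

section Uniqueness

variable (ψ : DrinfeldDouble k G →ₐc[k] DrinfeldDouble k H)

theorem mul_coord_map_comul (z : DrinfeldDouble k G) (h y h' y' : H) :
    LinearMap.mul' k k (TensorProduct.map (coord k h y) (coord k h' y')
      (TensorProduct.map (ψ : DrinfeldDouble k G →ₗ[k] DrinfeldDouble k H)
        (ψ : DrinfeldDouble k G →ₗ[k] DrinfeldDouble k H) (Coalgebra.comul z)))
      = if y = y' then coord k (h' * h) y (ψ z) else 0 := by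
  rw [← mul_coord_comul]
  congr 2
  exact CoalgHomClass.map_comp_comul_apply ψ z

theorem sum_coord_mul_coord (g x : G) (h y h' y' : H) :
    ∑ a, coord k h y (ψ (e k a x)) * coord k h' y' (ψ (e k (g * a⁻¹) x))
      = if y = y' then coord k (h' * h) y (ψ (e k g x)) else 0 := by
  rw [← mul_coord_map_comul, comul_e]
  simp

theorem comul_grp (x : G) : Coalgebra.comul (R := k) (grp k x) = grp k x ⊗ₜ grp k x := by
  simp only [grp, map_sum, comul_e, TensorProduct.sum_tmul, TensorProduct.tmul_sum]
  conv_lhs => rw [Finset.sum_comm]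
  conv_rhs => rw [Finset.sum_comm]
  refine Finset.sum_congr rfl fun a _ => ?_
  exact Fintype.sum_equiv (Equiv.mulRight a⁻¹) _ _ fun b => by simp

theorem coord_grp_mul_coord_grp (x : G) (h y h' y' : H) :
    coord k h y (ψ (grp k x)) * coord k h' y' (ψ (grp k x))
      = if y = y' then coord k (h' * h) y (ψ (grp k x)) else 0 := by
  rw [← mul_coord_map_comul, comul_grp]
  simp

/-- On `k^G`, `ψ` is recovered from `p` and `u` by comultiplying: the two legs of `Δ` share their
`kH` part, so summing over `y'` keeps only `y' = y`. -/
theorem coord_map_e_one (g : G) (h y : H) : coord k h y (ψ (e k g 1))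
    = ∑ a, coord k 1 y (ψ (e k a 1)) * ∑ y', coord k h y' (ψ (e k (g * a⁻¹) 1)) := by
  simp only [Finset.mul_sum]
  rw [Finset.sum_comm]
  simp [sum_coord_mul_coord]

theorem coord_map_grp_eq (x : G) (h y : H) : coord k h y (ψ (grp k x))
    = coord k 1 y (ψ (grp k x)) * ∑ y', coord k h y' (ψ (grp k x)) := by
  simp [Finset.mul_sum, coord_grp_mul_coord_grp]

variable {ψ}

/-- The elements `e_g # 1` and `ε # x` generate `D(G)`, and their images are expressed through `p,
u` and `v, r` respectively. -/
theorem hom_ext_of_components {ψ' : DrinfeldDouble k G →ₐc[k] DrinfeldDouble k H}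
    (hp : compP ψ = compP ψ') (hu : compU ψ = compU ψ') (hr : compR ψ = compR ψ')
    (hv : compV ψ = compV ψ') : ψ = ψ' := by
  have h1 : ∀ g, ψ (e k g 1) = ψ' (e k g 1) := fun g => ext_coord fun h y => by
    rw [coord_map_e_one ψ, coord_map_e_one ψ']
    simp only [← coeff_compP, ← compU_apply, hp, hu]
  have h2 : ∀ x, ψ (grp k x) = ψ' (grp k x) := fun x => ext_coord fun h y => by
    rw [coord_map_grp_eq ψ, coord_map_grp_eq ψ']
    simp only [← coeff_compV, ← compR_apply, hr, hv]
  have : (ψ : DrinfeldDouble k G →ₗ[k] DrinfeldDouble k H) = ψ' := by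
    refine hom_ext fun g x => ?_
    change ψ (e k g x) = ψ' (e k g x)
    rw [← e_one_mul_grp, map_mul, map_mul, h1, h2]
  exact DFunLike.ext _ _ fun z => LinearMap.congr_fun this z

theorem IsFlip.unique {φ φ' : DrinfeldDouble k H →ₐc[k] DrinfeldDouble k G} (h : IsFlip ψ φ)
    (h' : IsFlip ψ φ') : φ = φ' :=
  hom_ext_of_components (h.p_eq.trans h'.p_eq.symm) (h.u_eq.trans h'.u_eq.symm)
    (h.r_eq.trans h'.r_eq.symm) (h.v_eq.trans h'.v_eq.symm)

end Uniqueness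

end Coordinates

/-! ### Morphisms built from centrally supported data. -/

section CentralData

variable {k G H : Type*} [Field k] [Group G] [Fintype G] [DecidableEq G]
  [Group H] [Fintype H] [DecidableEq H]

variable (k G H) in
/-- Components of a morphism `D(G) → D(H)`: the matrix `p` of a Hopf algebra map `k^G → kH` with
central image and coimage, the homomorphism `w : H → G` dual to the component `k^G → k^H`, the
bicharacter `r`, and a homomorphism `v : G → H`, where `v` and `w` are mutually inverse modulo
centers. -/
structure CentralData where
  p : G → H → k
  r : G → H → k
  v : G →* H
  w : H →* G
  mem_center_left : ∀ {g h}, p g h ≠ 0 → g ∈ Subgroup.center G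
  mem_center_right : ∀ {g h}, p g h ≠ 0 → h ∈ Subgroup.center H
  sum_p_left : ∀ h, ∑ g, p g h = if h = 1 then 1 else 0
  sum_p_right : ∀ g, ∑ h, p g h = if g = 1 then 1 else 0
  conv_left : ∀ g h h', ∑ a, p a h * p (a⁻¹ * g) h' = if h = h' then p g h else 0
  conv_right : ∀ h g g', ∑ a, p g a * p g' (a⁻¹ * h) = if g = g' then p g h else 0
  r_one_left : ∀ h, r 1 h = 1
  r_one_right : ∀ g, r g 1 = 1
  r_mul_left : ∀ g g' h, r (g * g') h = r g h * r g' h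
  r_mul_right : ∀ g h h', r g (h * h') = r g h * r g h'
  w_v : ∀ g, g⁻¹ * w (v g) ∈ Subgroup.center G
  v_w : ∀ h, h⁻¹ * v (w h) ∈ Subgroup.center H

namespace CentralData

/-- The data with the two groups exchanged. -/
def swap (d : CentralData k G H) : CentralData k H G where
  p h g := d.p g h
  r h g := d.r g h
  v := d.w
  w := d.v
  mem_center_left := d.mem_center_right
  mem_center_right := d.mem_center_left
  sum_p_left := d.sum_p_right
  sum_p_right := d.sum_p_left
  conv_left := d.conv_right
  conv_right := d.conv_left
  r_one_left := d.r_one_right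
  r_one_right := d.r_one_left
  r_mul_left _ _ _ := d.r_mul_right _ _ _
  r_mul_right _ _ _ := d.r_mul_left _ _ _
  w_v := d.v_w
  v_w := d.w_v

variable (d : CentralData k G H)

/-- Conjugation fixes central elements, and off the center both sides vanish. -/
theorem p_conj_left (x g : G) (h : H) : d.p (x * g * x⁻¹) h = d.p g h := by
  by_cases hg : g ∈ Subgroup.center G
  · rw [Subgroup.mem_center_iff.1 hg x, mul_inv_cancel_right]
  · have hg' : x * g * x⁻¹ ∉ Subgroup.center G := fun hx => hg <| by
      have := Subgroup.Normal.conj_mem inferInstance _ hx x⁻¹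
      convert this using 1
      group
    rw [not_not.1 (mt d.mem_center_left hg), not_not.1 (mt d.mem_center_left hg')]

theorem p_mul_comm_left (x g : G) (h : H) : d.p (x * g) h = d.p (g * x) h := by
  rw [← d.p_conj_left x (g * x), ← mul_assoc, mul_inv_cancel_right]

theorem r_conj_right (g : G) (x h : H) : d.r g (x * h * x⁻¹) = d.r g h := by
  rw [d.r_mul_right, d.r_mul_right, mul_right_comm, ← d.r_mul_right, mul_inv_cancel,
    d.r_one_right, one_mul]

/-- `w (v x)` differs from `x` by a central factor, which conjugation does not see. -/
theorem w_conj (x : G) (h : H) : d.w (d.v x * h * (d.v x)⁻¹) = x * d.w h * x⁻¹ := by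
  obtain ⟨z, hz, hx⟩ : ∃ z ∈ Subgroup.center G, d.w (d.v x) = x * z := ⟨_, d.w_v x, by group⟩
  have hz' := Subgroup.mem_center_iff.1 hz
  simp only [map_mul, map_inv, hx, mul_inv_rev]
  rw [mul_assoc x z, ← hz' (d.w h)]
  group

/-- The linear map `D(G) → D(H)` with the given components. -/
def toLinearMap : DrinfeldDouble k G →ₗ[k] DrinfeldDouble k H :=
  lin fun g x => ∑ h, ∑ y, (d.p (g * (d.w h)⁻¹) y * d.r x h) • e k h (y * d.v x)

theorem toLinearMap_e (g x : G) : d.toLinearMap (e k g x)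
    = ∑ h, ∑ y, (d.p (g * (d.w h)⁻¹) y * d.r x h) • e k h (y * d.v x) := lin_e _ _ _

theorem coord_toLinearMap (g x : G) (h y : H) : coord k h y (d.toLinearMap (e k g x))
    = d.p (g * (d.w h)⁻¹) (y * (d.v x)⁻¹) * d.r x h := by
  simp only [toLinearMap_e, map_sum, map_smul, coord_e, smul_eq_mul]
  rw [Finset.sum_eq_single h, Finset.sum_eq_single (y * (d.v x)⁻¹)]
  · simp
  · intro b _ hb
    rw [if_neg, mul_zero]
    rintro ⟨-, rfl⟩
    simp at hb
  · simp
  · intro b _ hb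
    simp [hb]
  · simp

theorem toLinearMap_one : d.toLinearMap 1 = 1 := by
  simp only [one_def, map_sum, toLinearMap_e, d.r_one_left, map_one, mul_one]
  rw [Finset.sum_comm]
  refine Finset.sum_congr rfl fun h _ => ?_
  rw [Finset.sum_comm]
  have : ∀ y, ∑ g, d.p (g * (d.w h)⁻¹) y = if y = 1 then 1 else 0 := fun y => by
    rw [← d.sum_p_left]
    exact Fintype.sum_equiv (Equiv.mulRight (d.w h)⁻¹) _ _ fun _ => rfl
  simp only [← Finset.sum_smul, this]
  simp

/-- The product of two elements of `kH` with coefficients in rows of `p`. -/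
theorem sum_sum_p_smul {M : Type*} [AddCommGroup M] [Module k M] (g g' : G) (f : H → M) :
    ∑ y, ∑ y', (d.p g y * d.p g' y') • f (y * y')
      = if g = g' then ∑ y, d.p g y • f y else 0 := by
  have : ∀ y, ∑ y', (d.p g y * d.p g' y') • f (y * y')
      = ∑ t, (d.p g y * d.p g' (y⁻¹ * t)) • f t := fun y =>
    Fintype.sum_equiv (Equiv.mulLeft y) _ _ fun t => by simp
  simp only [this]
  rw [Finset.sum_comm]
  simp only [← Finset.sum_smul, d.conv_right, ite_smul, zero_smul]
  split_ifs <;> simp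

/-- The left factor selects the summand at `v(x)⁻¹ h v(x)`, since the central `y` does not act by
conjugation. There `w` takes the value `x⁻¹ w(h) x`, which replaces `g'` by `x g' x⁻¹`, the twist in
the product of `D(G)`. -/
theorem e_mul_toLinearMap_e (h y : H) (x g' x' : G) (hy : y ∈ Subgroup.center H) :
    e k h (y * d.v x) * d.toLinearMap (e k g' x')
      = ∑ y', (d.p (x * g' * x⁻¹ * (d.w h)⁻¹) y' * d.r x' h) •
          e k h (y * y' * d.v (x * x')) := by
  have hy' := Subgroup.mem_center_iff.1 hy
  have hiff : ∀ b, h = y * d.v x * b * (y * d.v x)⁻¹ ↔ b = (d.v x)⁻¹ * h * d.v x := fun b => by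
    have : y * d.v x * b * (y * d.v x)⁻¹ = y * (d.v x * b * (d.v x)⁻¹) * y⁻¹ := by group
    rw [this, ← hy', mul_inv_cancel_right]
    constructor <;> rintro rfl <;> group
  simp only [toLinearMap_e, Finset.mul_sum, mul_smul_comm, e_mul_e]
  rw [Finset.sum_eq_single ((d.v x)⁻¹ * h * d.v x)]
  · refine Finset.sum_congr rfl fun y' _ => ?_
    rw [if_pos]
    · have h1 : d.r x' ((d.v x)⁻¹ * h * d.v x) = d.r x' h := by
        rw [← d.r_conj_right x' (d.v x)]
        congr 1
        group
      have h2 : d.w ((d.v x)⁻¹ * h * d.v x) = x⁻¹ * d.w h * x := by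
        have := d.w_conj x⁻¹ h
        simpa using this
      have h3 : d.p (g' * (x⁻¹ * d.w h * x)⁻¹) y' = d.p (x * g' * x⁻¹ * (d.w h)⁻¹) y' := by
        rw [← d.p_conj_left x]
        congr 1
        group
      rw [h1, h2, h3]
      by_cases hp : d.p (x * g' * x⁻¹ * (d.w h)⁻¹) y' = 0
      · simp [hp]
      · have hy'' := Subgroup.mem_center_iff.1 (d.mem_center_right hp)
        congr 2
        rw [map_mul, ← mul_assoc, mul_assoc y, hy'' (d.v x)]
        group
    · exact (hiff _).2 rfl
  · intro b _ hb
    exact Finset.sum_eq_zero fun y' _ => by rw [if_neg (mt (hiff b).1 hb), smul_zero]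
  · simp

theorem toLinearMap_mul (a b : DrinfeldDouble k G) :
    d.toLinearMap (a * b) = d.toLinearMap a * d.toLinearMap b := by
  suffices key : ∀ g x g' x', d.toLinearMap (e k g x * e k g' x')
      = d.toLinearMap (e k g x) * d.toLinearMap (e k g' x') by
    have H' : (LinearMap.mul k (DrinfeldDouble k G)).compr₂ d.toLinearMap
        = (LinearMap.mul k (DrinfeldDouble k H)).compl₁₂ d.toLinearMap d.toLinearMap :=
      hom_ext fun _ _ => hom_ext fun _ _ => key _ _ _ _
    exact LinearMap.congr_fun (LinearMap.congr_fun H' a) b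
  intro g x g' x'
  have h1 : d.toLinearMap (e k g x) * d.toLinearMap (e k g' x')
      = ∑ h, ∑ y, ∑ y', (d.p (g * (d.w h)⁻¹) y * d.p (x * g' * x⁻¹ * (d.w h)⁻¹) y') •
          (d.r (x * x') h • e k h (y * y' * d.v (x * x'))) := by
    rw [d.toLinearMap_e g x, Finset.sum_mul]
    refine Finset.sum_congr rfl fun h _ => ?_
    rw [Finset.sum_mul]
    refine Finset.sum_congr rfl fun y _ => ?_
    by_cases hp : d.p (g * (d.w h)⁻¹) y = 0
    · simp [hp]
    · rw [smul_mul_assoc, d.e_mul_toLinearMap_e h y x g' x' (d.mem_center_right hp),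
        Finset.smul_sum]
      refine Finset.sum_congr rfl fun y' _ => ?_
      rw [smul_smul, smul_smul, d.r_mul_left]
      congr 1
      ring
  rw [h1]
  -- The rows of `p` are orthogonal idempotents of `kH`, which produces the Kronecker delta of the
  -- product in `D(G)`.
  have h2 : ∀ h, ∑ y, ∑ y', (d.p (g * (d.w h)⁻¹) y * d.p (x * g' * x⁻¹ * (d.w h)⁻¹) y') •
      (d.r (x * x') h • e k h (y * y' * d.v (x * x')))
        = if g = x * g' * x⁻¹ then ∑ y, d.p (g * (d.w h)⁻¹) y •
          (d.r (x * x') h • e k h (y * d.v (x * x'))) else 0 := fun h => by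
    have := d.sum_sum_p_smul (g * (d.w h)⁻¹) (x * g' * x⁻¹ * (d.w h)⁻¹)
      (fun t => d.r (x * x') h • e k h (t * d.v (x * x')))
    rwa [if_congr (mul_left_inj _) rfl rfl] at this
  simp only [h2, e_mul_e]
  split_ifs
  · simp only [toLinearMap_e, smul_smul]
  · simp

theorem counit_toLinearMap (z : DrinfeldDouble k G) :
    Coalgebra.counit (R := k) (d.toLinearMap z) = Coalgebra.counit (R := k) z := by
  have H : Coalgebra.counit ∘ₗ d.toLinearMap = (Coalgebra.counit : _ →ₗ[k] k) := by
    refine hom_ext fun g x => ?_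
    simp only [LinearMap.coe_comp, Function.comp_apply, counit_eq_sum_coord (k := k) (d.toLinearMap _),
      coord_toLinearMap, counit_e, d.r_one_right, map_one, inv_one, mul_one, ← d.sum_p_right]
    exact Fintype.sum_equiv (Equiv.mulRight (d.v x)⁻¹) _ _ fun _ => rfl
  exact LinearMap.congr_fun H z

theorem comul_toLinearMap (z : DrinfeldDouble k G) :
    TensorProduct.map d.toLinearMap d.toLinearMap (Coalgebra.comul z)
      = Coalgebra.comul (d.toLinearMap z) := by
  have H : TensorProduct.map d.toLinearMap d.toLinearMap ∘ₗ Coalgebra.comul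
      = Coalgebra.comul ∘ₗ d.toLinearMap := by
    refine hom_ext fun g x => ?_
    refine tensor_ext_coord fun h y h' y' => ?_
    rw [LinearMap.comp_apply, LinearMap.comp_apply, mul_coord_comul, comul_e]
    simp only [map_sum, TensorProduct.map_tmul, coord_toLinearMap, LinearMap.mul'_apply]
    -- The columns of `p` are orthogonal idempotents of `kG`. On their support `b * (d.w h)⁻¹` is
    -- central, so the factors can be reordered to match the reversed product `h' * h` of the
    -- co-opposite comultiplication.
    have key : ∑ b, d.p (b * (d.w h)⁻¹) (y * (d.v x)⁻¹) *
        d.p (g * b⁻¹ * (d.w h')⁻¹) (y' * (d.v x)⁻¹)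
        = if y = y' then d.p (g * (d.w (h' * h))⁻¹) (y * (d.v x)⁻¹) else 0 := by
      rw [← if_congr (mul_left_inj (d.v x)⁻¹) rfl rfl, ← d.conv_left]
      refine Fintype.sum_equiv (Equiv.mulRight (d.w h)⁻¹) _ _ fun b => ?_
      rw [Equiv.coe_mulRight]
      by_cases hp : d.p (b * (d.w h)⁻¹) (y * (d.v x)⁻¹) = 0
      · simp [hp]
      · have hc := Subgroup.mem_center_iff.1 (Subgroup.inv_mem _ (d.mem_center_left hp))
        have : g * b⁻¹ * (d.w h')⁻¹ = (b * (d.w h)⁻¹)⁻¹ * (g * (d.w (h' * h))⁻¹) := calc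
          _ = g * (d.w h)⁻¹ * ((b * (d.w h)⁻¹)⁻¹ * (d.w h')⁻¹) := by group
          _ = g * (d.w (h' * h))⁻¹ * (b * (d.w h)⁻¹)⁻¹ := by rw [← hc, map_mul]; group
          _ = _ := hc _
        rw [this]
    split_ifs at key ⊢
    · rw [d.r_mul_right, ← mul_assoc, mul_right_comm _ _ (d.r x h), mul_assoc, ← key,
        Finset.sum_mul]
      exact Finset.sum_congr rfl fun _ _ => by ring
    · calc _ = (∑ b, d.p (b * (d.w h)⁻¹) (y * (d.v x)⁻¹) *
          d.p (g * b⁻¹ * (d.w h')⁻¹) (y' * (d.v x)⁻¹)) * (d.r x h * d.r x h') := by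
            rw [Finset.sum_mul]
            exact Finset.sum_congr rfl fun _ _ => by ring
        _ = 0 := by rw [key, zero_mul]
  exact LinearMap.congr_fun H z

/-- The morphism `D(G) → D(H)` with the given components. -/
def toBialgHom : DrinfeldDouble k G →ₐc[k] DrinfeldDouble k H :=
  BialgHom.ofAlgHom (AlgHom.ofLinearMap d.toLinearMap d.toLinearMap_one d.toLinearMap_mul)
    (AlgHom.ext d.counit_toLinearMap) (AlgHom.ext d.comul_toLinearMap)

theorem coord_toBialgHom (g x : G) (h y : H) : coord k h y (d.toBialgHom (e k g x))
    = d.p (g * (d.w h)⁻¹) (y * (d.v x)⁻¹) * d.r x h := d.coord_toLinearMap g x h y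

/-- The coefficient formula is carried to itself by exchanging `v` with `w` and the arguments of `p`
and `r`. -/
theorem isAdjoint_toBialgHom_swap : IsAdjoint d.toBialgHom d.swap.toBialgHom := by
  intro g x h y
  rw [coord_toBialgHom, coord_toBialgHom]
  rfl

end CentralData

end CentralData

/-! ### Auxiliary facts on group algebras and the two projections of the double. -/

section Structure

variable {k G H : Type*} [Field k] [Group G] [Fintype G] [DecidableEq G]
  [Group H] [Fintype H] [DecidableEq H]

theorem coeff_mul_eq_sum (a b : MonoidAlgebra k G) (g : G) :
    (a * b).coeff g = ∑ x, a.coeff x * b.coeff (x⁻¹ * g) := by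
  have h1 : a = ∑ x, MonoidAlgebra.single x (a.coeff x) :=
    MonoidAlgebra.ext (Finsupp.ext fun x => by simp)
  conv_lhs => rw [h1]
  simp [Finset.sum_mul, MonoidAlgebra.coeff_sum]

theorem mem_center_of_commute_single {g : G}
    (h : ∀ c : MonoidAlgebra k G, Commute (MonoidAlgebra.single g 1) c) :
    g ∈ Subgroup.center G :=
  Subgroup.mem_center_iff.2 fun x => by
    have := (h (MonoidAlgebra.single x 1)).eq
    simp only [MonoidAlgebra.single_mul_single, mul_one] at this
    exact (MonoidAlgebra.single_left_injective one_ne_zero this).symm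

theorem commute_of_smul {R A : Type*} [Field R] [Ring A] [Algebra R A] {r : R} (hr : r ≠ 0)
    {a b : A} (h : Commute (r • a) b) : Commute a b := by
  have := h.smul_left r⁻¹
  rwa [smul_smul, inv_mul_cancel₀ hr, one_smul] at this

/-- Idempotent scalars are `0` or `1`, and orthogonality allows only one `1`. This is how the points
`v(x)` and `w(h)` arise. -/
theorem exists_eq_ite {ι : Type*} [Fintype ι] [DecidableEq ι] {f : ι → k}
    (hf : ∀ i j, f i * f j = if i = j then f i else 0) (h1 : ∑ i, f i = 1) :
    ∃ i, ∀ j, f j = if j = i then 1 else 0 := by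
  obtain ⟨i, -, hi⟩ := Finset.exists_ne_zero_of_sum_ne_zero (h1.trans_ne one_ne_zero)
  refine ⟨i, fun j => ?_⟩
  split_ifs with hj
  · subst hj
    have := hf j j
    rw [if_pos rfl] at this
    exact mul_right_cancel₀ hi (this.trans (one_mul _).symm)
  · have := hf j i
    rw [if_neg hj] at this
    exact (mul_eq_zero.1 this).resolve_right hi

theorem projGrp_mul (a b : DrinfeldDouble k G) :
    projGrp k G (a * b) = projGrp k G a * projGrp k G b := by
  have H : (LinearMap.mul k (DrinfeldDouble k G)).compr₂ (projGrp k G)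
      = (LinearMap.mul k (MonoidAlgebra k G)).compl₁₂ (projGrp k G) (projGrp k G) := by
    refine hom_ext fun g x => hom_ext fun g' x' => ?_
    simp only [LinearMap.compr₂_apply, LinearMap.mul_apply', e_mul_e, LinearMap.compl₁₂_apply,
      projGrp, lin_e]
    by_cases h : g' = 1
    · subst h
      by_cases hg : g = 1 <;> simp [hg, lin_e]
    · by_cases hg : g = 1
      · have : ¬ (1 : G) = x * g' * x⁻¹ := fun hx => h <| by
          simpa [eq_comm, mul_inv_eq_one] using hx
        simp [hg, h, this]
      · split_ifs <;> simp [hg, lin_e]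
  exact LinearMap.congr_fun (LinearMap.congr_fun H a) b

theorem projGrp_one : projGrp k G 1 = 1 := by
  simp [one_def, projGrp, lin_e, MonoidAlgebra.one_def]

theorem projFun_one : projFun k G 1 = 1 := by
  ext h
  simp [one_def, projFun, lin_e, Pi.single_apply]

theorem projFun_e_mul (g y h : G) (b : DrinfeldDouble k G) :
    projFun k G (e k g y * b) h = if g = h then projFun k G b (y⁻¹ * g * y) else 0 := by
  have H : LinearMap.proj h ∘ₗ projFun k G ∘ₗ LinearMap.mulLeft k (e k g y)
      = if g = h then LinearMap.proj (y⁻¹ * g * y) ∘ₗ projFun k G else 0 := by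
    refine hom_ext fun a c => ?_
    have hiff : g = y * a * y⁻¹ ↔ y⁻¹ * g * y = a := by
      constructor <;> rintro rfl <;> group
    by_cases hg : g = h
    · subst hg
      by_cases hy : y⁻¹ * g * y = a <;> simp [e_mul_e, hiff, hy, projFun, lin_e]
    · by_cases hy : y⁻¹ * g * y = a <;>
        simp [e_mul_e, hiff, hy, projFun, lin_e, hg, Ne.symm hg]
  have := LinearMap.congr_fun H b
  split_ifs at this ⊢ <;> simpa using this

/-- In general `id ⊗ ε` is not multiplicative, because `y` conjugates the function part of the next
factor; central `y` does not. -/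
theorem projFun_mul_of_forall_mem_center {z : DrinfeldDouble k G} {h : G}
    (hz : ∀ y, coord k h y z ≠ 0 → y ∈ Subgroup.center G) (b : DrinfeldDouble k G) :
    projFun k G (z * b) h = projFun k G z h * projFun k G b h := by
  conv_lhs => rw [← sum_coord_smul_e z]
  simp only [Finset.sum_mul, smul_mul_assoc, map_sum, map_smul, Finset.sum_apply, Pi.smul_apply,
    projFun_e_mul, smul_eq_mul, mul_ite, mul_zero]
  rw [Finset.sum_eq_single h]
  · simp only [if_true]
    rw [projFun_apply z, Finset.sum_mul]
    refine Finset.sum_congr rfl fun y _ => ?_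
    by_cases hy : coord k h y z = 0
    · simp [hy]
    · rw [mul_assoc, Subgroup.mem_center_iff.1 (hz y hy) h, inv_mul_cancel_left]
  · intro b _ hb
    simp [hb]
  · simp

theorem projFun_sum_smul_e_mul (α : G → k) (y : G) (b : DrinfeldDouble k G) (h : G) :
    projFun k G ((∑ g, α g • e k g y) * b) h = α h * projFun k G b (y⁻¹ * h * y) := by
  simp [Finset.sum_mul, projFun_e_mul]

/-- Moving a class function past a group element does not change it. -/
theorem coord_mul_sum_smul_e {α : G → k} (hα : ∀ x g, α (x⁻¹ * g * x) = α g) (y : G)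
    (b : DrinfeldDouble k G) (h z : G) :
    coord k h z (b * ∑ g, α g • e k g y) = coord k h (z * y⁻¹) b * α h := by
  have H : coord k h z ∘ₗ LinearMap.mulRight k (∑ g, α g • e k g y)
      = α h • coord k h (z * y⁻¹) := by
    refine hom_ext fun a c => ?_
    have hiff : ∀ g, a = c * g * c⁻¹ ↔ g = c⁻¹ * a * c := fun g => by
      constructor <;> rintro rfl <;> group
    have hac : e k a c * ∑ g, α g • e k g y = α a • e k a (c * y) := by
      simp [Finset.mul_sum, e_mul_e, hiff, hα]
    rw [LinearMap.comp_apply, LinearMap.mulRight_apply, hac]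
    by_cases ha : a = h
    · simp [ha, coord_e, eq_mul_inv_iff_mul_eq]
    · simp [ha, coord_e]
  rw [mul_comm]
  exact LinearMap.congr_fun H b

theorem projFun_mul_sum_smul_e {α : G → k} (hα : ∀ x g, α (x⁻¹ * g * x) = α g) (y : G)
    (b : DrinfeldDouble k G) (h : G) :
    projFun k G (b * ∑ g, α g • e k g y) h = projFun k G b h * α h := by
  simp only [projFun_apply, coord_mul_sum_smul_e hα, ← Finset.sum_mul]
  congr 1
  exact Fintype.sum_equiv (Equiv.mulRight y⁻¹) _ _ fun _ => rfl

/-! ### Rows of the matrix and central support of `p`. -/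

variable (ψ : DrinfeldDouble k G →ₐc[k] DrinfeldDouble k H)

/-- The element `∑_g ψ(e_g # 1)_{h, y} g` of `kG`. -/
def matrixRow (h y : H) : MonoidAlgebra k G :=
  ∑ g, MonoidAlgebra.single g (coord k h y (ψ (e k g 1)))

theorem coeff_matrixRow (h y : H) (g : G) :
    (matrixRow ψ h y).coeff g = coord k h y (ψ (e k g 1)) := by
  simp [matrixRow, Finsupp.single_apply]

/-- This is compatibility of `ψ` with `Δ`, since the comultiplication of `k^G` is dual to the
product of `kG`. -/
theorem matrixRow_mul (h' y' h y : H) :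
    matrixRow ψ h' y' * matrixRow ψ h y = if y = y' then matrixRow ψ (h' * h) y else 0 := by
  refine MonoidAlgebra.ext (Finsupp.ext fun g => ?_)
  have : ∑ x, coord k h' y' (ψ (e k x 1)) * coord k h y (ψ (e k (x⁻¹ * g) 1))
      = if y = y' then coord k (h' * h) y (ψ (e k g 1)) else 0 := by
    rw [← sum_coord_mul_coord]
    refine Fintype.sum_equiv ((Equiv.inv G).trans (Equiv.mulRight g)) _ _ fun x => ?_
    simp [mul_comm]
  rw [coeff_mul_eq_sum]
  simp only [coeff_matrixRow, this]
  split_ifs <;> simp [coeff_matrixRow]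

theorem commute_matrixRow_one (y h y' : H) :
    Commute (matrixRow ψ 1 y) (matrixRow ψ h y') := by
  rw [commute_iff_eq, matrixRow_mul, matrixRow_mul, one_mul, mul_one]
  by_cases hy : y = y'
  · simp [hy]
  · rw [if_neg hy, if_neg (Ne.symm hy)]

variable {ψ}

/-- The rows span `kG`: a functional `f` vanishing on all of them gives the kernel element `∑ f(g)
e_g # 1` of `ψ`. The argument is applied to the centralizer of `z`, which contains the rows. -/
theorem commute_of_commute_matrixRow (hψ : Function.Injective ψ) {z : MonoidAlgebra k G}
    (hz : ∀ h y, Commute z (matrixRow ψ h y)) (c : MonoidAlgebra k G) : Commute z c := by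
  let C : Submodule k (MonoidAlgebra k G) :=
    LinearMap.ker (LinearMap.mulLeft k z - LinearMap.mulRight k z)
  have hC : ∀ c, c ∈ C ↔ Commute z c := fun c => by
    simp [C, sub_eq_zero, commute_iff_eq]
  rw [← hC]
  by_contra hc
  obtain ⟨f, hf, hle⟩ := C.exists_le_ker_of_lt_top (lt_top_iff_ne_top.2 fun h => hc (h ▸ trivial))
  apply hf
  have h0 : ψ (∑ g, f (MonoidAlgebra.single g 1) • e k g 1) = 0 := by
    refine ext_coord fun h y => ?_
    have := hle ((hC _).2 (hz h y))
    simp only [LinearMap.mem_ker, matrixRow, map_sum] at this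
    simp only [map_sum, map_smul, smul_eq_mul, map_zero]
    rw [← this]
    refine Finset.sum_congr rfl fun g _ => ?_
    rw [mul_comm, ← smul_eq_mul, ← map_smul, MonoidAlgebra.smul_single, smul_eq_mul, mul_one]
  have h1 := hψ (h0.trans (map_zero ψ).symm)
  refine linearMap_grp_ext fun g => ?_
  have h2 := coord_sum_e (fun g => f (MonoidAlgebra.single g 1)) g 1 1
  rw [h1, map_zero, if_pos rfl] at h2
  rw [← h2, LinearMap.zero_apply]

theorem sum_coord_one_left (h : H) :
    ∑ g, coord k 1 h (ψ (e k g 1)) = if h = 1 then 1 else 0 := by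
  have : ∑ g, coord k 1 h (ψ (e k g 1)) = coord k 1 h (ψ 1) := by
    rw [one_def]
    simp
  rw [this, map_one, ← grp_one, coord_grp, if_congr eq_comm rfl rfl]

theorem sum_coord_one_right (g : G) :
    ∑ h, coord k 1 h (ψ (e k g 1)) = if g = 1 then 1 else 0 := by
  rw [← counit_eq_sum_coord, ← counit_e g 1]
  exact CoalgHomClass.counit_comp_apply ψ _

theorem conv_coord_left (g : G) (h h' : H) :
    ∑ a, coord k 1 h (ψ (e k a 1)) * coord k 1 h' (ψ (e k (a⁻¹ * g) 1))
      = if h = h' then coord k 1 h (ψ (e k g 1)) else 0 := by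
  have := congrArg (fun c => c.coeff g) (matrixRow_mul ψ 1 h 1 h')
  simp only [coeff_mul_eq_sum, coeff_matrixRow] at this
  rw [this, mul_one]
  by_cases hh : h = h'
  · simp [hh, coeff_matrixRow]
  · simp [hh, Ne.symm hh]

theorem conv_coord_right (h : H) (g g' : G) :
    ∑ a, coord k 1 a (ψ (e k g 1)) * coord k 1 (a⁻¹ * h) (ψ (e k g' 1))
      = if g = g' then coord k 1 h (ψ (e k g 1)) else 0 := by
  simp only [← coeff_projGrp]
  rw [← coeff_mul_eq_sum, ← projGrp_mul, ← map_mul, e_mul_e]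
  by_cases hg : g = g' <;> simp [hg]

/-- The rows with `h = 1` commute with all rows, hence are central. Idempotency and orthogonality of
the elements `p(e_g)` allow a nonzero multiple of `g` to be written as a combination of them. -/
theorem mem_center_left_of_coord_ne_zero (hψ : Function.Injective ψ) {g : G} {y : H}
    (h : coord k 1 y (ψ (e k g 1)) ≠ 0) : g ∈ Subgroup.center G := by
  refine mem_center_of_commute_single (k := k) fun c => commute_of_smul h ?_
  have : coord k 1 y (ψ (e k g 1)) • MonoidAlgebra.single g (1 : k)
      = ∑ a, coord k 1 a (ψ (e k g 1)) • matrixRow ψ 1 (a⁻¹ * y) := by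
    refine MonoidAlgebra.ext (Finsupp.ext fun g' => ?_)
    simp [coeff_matrixRow, conv_coord_right, Finsupp.single_apply]
  rw [this]
  exact Commute.sum_left _ _ _ fun a _ =>
    (commute_of_commute_matrixRow hψ (fun _ _ => commute_matrixRow_one ψ _ _ _) c).smul_left _

theorem projGrp_map_e (g x : G) : projGrp k H (ψ (e k g x))
    = projGrp k H (ψ (e k g 1)) * projGrp k H (ψ (grp k x)) := by
  rw [← projGrp_mul, ← map_mul, e_one_mul_grp]

theorem commute_of_commute_projGrp (hψ : Function.Surjective ψ) {z : MonoidAlgebra k H}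
    (h1 : ∀ g, Commute z (projGrp k H (ψ (e k g 1))))
    (h2 : ∀ x, Commute z (projGrp k H (ψ (grp k x)))) (c : MonoidAlgebra k H) :
    Commute z c := by
  obtain ⟨b, rfl⟩ : ∃ b, projGrp k H b = c := by
    refine ⟨inclGrp k H c, LinearMap.congr_fun (f := projGrp k H ∘ₗ inclGrp k H)
      (g := LinearMap.id) (linearMap_grp_ext fun x => ?_) c⟩
    rw [LinearMap.comp_apply, inclGrp_single]
    simp [grp, projGrp, lin_e]
  obtain ⟨a, rfl⟩ := hψ b
  rw [← sum_coord_smul_e a]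
  simp only [map_sum, map_smul]
  refine Commute.sum_right _ _ _ fun g _ => Commute.sum_right _ _ _ fun x _ => ?_
  rw [projGrp_map_e]
  exact ((h1 g).mul_right (h2 x)).smul_right _

/-- `p(e_g)` commutes with the image of the commutative algebra `k^G`. It commutes with the image of
`ε # x` because either `g` is central, so the two commute already in `D(G)`, or `p(e_g) = 0`. -/
theorem commute_projGrp_map_e (hψ : Function.Bijective ψ) (g : G) (c : MonoidAlgebra k H) :
    Commute (projGrp k H (ψ (e k g 1))) c := by
  have hc : ∀ g g' : G, Commute (e k g 1) (e k g' 1) := fun g g' => by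
    rw [commute_iff_eq, e_mul_e, e_mul_e]
    by_cases h : g = g'
    · simp [h]
    · simp [h, Ne.symm h]
  refine commute_of_commute_projGrp hψ.2 (fun g' => ?_) (fun x => ?_) c
  · rw [commute_iff_eq, ← projGrp_mul, ← projGrp_mul, ← map_mul, ← map_mul, (hc g g').eq]
  · by_cases hg : g ∈ Subgroup.center G
    · rw [commute_iff_eq, ← projGrp_mul, ← projGrp_mul, ← map_mul, ← map_mul, grp_mul_e_one,
        Subgroup.mem_center_iff.1 hg, mul_inv_cancel_right]
    · have : projGrp k H (ψ (e k g 1)) = 0 := MonoidAlgebra.ext (Finsupp.ext fun y => by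
        rw [coeff_projGrp]
        exact not_not.1 (mt (mem_center_left_of_coord_ne_zero hψ.1) hg))
      rw [this]
      exact Commute.zero_left _

theorem mem_center_right_of_coord_ne_zero (hψ : Function.Bijective ψ) {g : G} {y : H}
    (h : coord k 1 y (ψ (e k g 1)) ≠ 0) : y ∈ Subgroup.center H := by
  refine mem_center_of_commute_single (k := k) fun c => commute_of_smul h ?_
  have : coord k 1 y (ψ (e k g 1)) • MonoidAlgebra.single y (1 : k)
      = ∑ a, coord k 1 y (ψ (e k a 1)) • projGrp k H (ψ (e k (a⁻¹ * g) 1)) := by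
    refine MonoidAlgebra.ext (Finsupp.ext fun g' => ?_)
    simp [coeff_projGrp, conv_coord_left, Finsupp.single_apply]
  rw [this]
  exact Commute.sum_left _ _ _ fun a _ => (commute_projGrp_map_e hψ _ _).smul_left _

/-! ### The homomorphisms `v`, `w` and the bicharacter `r`. -/

variable (ψ) in
theorem exists_projGrp_map_grp :
    ∃ v : G →* H, ∀ x, projGrp k H (ψ (grp k x)) = MonoidAlgebra.single (v x) 1 := by
  have h : ∀ x, ∃ y, projGrp k H (ψ (grp k x)) = MonoidAlgebra.single y 1 := fun x => by
    -- `ε # x` is group-like, so the coefficients of its image in `kH` are orthogonal idempotents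
    -- with sum `1`.
    obtain ⟨y, hy⟩ := exists_eq_ite (f := fun y => coord k 1 y (ψ (grp k x)))
      (fun i j => by simp [coord_grp_mul_coord_grp]) (by
        rw [← counit_eq_sum_coord]
        exact (CoalgHomClass.counit_comp_apply ψ _).trans
          (by simp [counit_eq_sum_coord, coord_grp]))
    refine ⟨y, MonoidAlgebra.ext (Finsupp.ext fun y' => ?_)⟩
    rw [coeff_projGrp, hy]
    simp [Finsupp.single_apply, eq_comm]
  choose v hv using h
  have hinj : Function.Injective fun y : H => MonoidAlgebra.single y (1 : k) :=
    MonoidAlgebra.single_left_injective one_ne_zero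
  refine ⟨⟨⟨v, hinj ?_⟩, fun x x' => hinj ?_⟩, hv⟩
  · simp only [← hv, grp_one, map_one, projGrp_one, MonoidAlgebra.one_def]
  · have := MonoidAlgebra.single_mul_single (v x) (v x') (1 : k) 1
    rw [mul_one] at this
    simp only [← this, ← hv, ← projGrp_mul, ← map_mul, grp_mul_grp]

theorem coord_one_map_grp {v : G →* H}
    (hv : ∀ x, projGrp k H (ψ (grp k x)) = MonoidAlgebra.single (v x) 1) (x : G) (y : H) :
    coord k 1 y (ψ (grp k x)) = if v x = y then 1 else 0 := by
  rw [← coeff_projGrp, hv]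
  simp [Finsupp.single_apply]

theorem map_grp_eq {v : G →* H}
    (hv : ∀ x, projGrp k H (ψ (grp k x)) = MonoidAlgebra.single (v x) 1) (x : G) :
    ψ (grp k x) = ∑ h, projFun k H (ψ (grp k x)) h • e k h (v x) := by
  refine ext_coord fun h y => ?_
  rw [coord_sum_e, coord_map_grp_eq, coord_one_map_grp hv, projFun_apply]
  split_ifs <;> simp

theorem projFun_map_grp_mul (x : G) (h h' : H) : projFun k H (ψ (grp k x)) (h * h')
    = projFun k H (ψ (grp k x)) h * projFun k H (ψ (grp k x)) h' := by
  rw [mul_comm (projFun _ _ _ _)]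
  simp only [projFun_apply, Finset.sum_mul, Finset.mul_sum]
  simp [coord_grp_mul_coord_grp]

theorem projFun_map_grp_one (x : G) : projFun k H (ψ (grp k x)) 1 = 1 := by
  rw [projFun_apply, ← counit_eq_sum_coord]
  exact (CoalgHomClass.counit_comp_apply ψ _).trans (by simp [counit_eq_sum_coord, coord_grp])

theorem projFun_map_grp_conj (x : G) (y h : H) :
    projFun k H (ψ (grp k x)) (y⁻¹ * h * y) = projFun k H (ψ (grp k x)) h := by
  rw [projFun_map_grp_mul, projFun_map_grp_mul, mul_right_comm, ← projFun_map_grp_mul,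
    inv_mul_cancel, projFun_map_grp_one, one_mul]

theorem projFun_map_grp_ne_zero (x : G) (h : H) : projFun k H (ψ (grp k x)) h ≠ 0 := by
  have := projFun_map_grp_mul (ψ := ψ) x h h⁻¹
  rw [mul_inv_cancel, projFun_map_grp_one] at this
  exact left_ne_zero_of_mul_eq_one this.symm

variable (ψ) in
theorem projFun_map_grp_mul_left (x x' : G) (h : H) : projFun k H (ψ (grp k (x * x'))) h
    = projFun k H (ψ (grp k x)) h * projFun k H (ψ (grp k x')) h := by
  obtain ⟨v, hv⟩ := exists_projGrp_map_grp ψ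
  rw [← grp_mul_grp, map_mul]
  conv_lhs => rw [map_grp_eq hv x]
  rw [projFun_sum_smul_e_mul, projFun_map_grp_conj]

theorem mem_center_of_coord_ne_zero (hψ : Function.Bijective ψ) {g : G} {h y : H}
    (hy : coord k h y (ψ (e k g 1)) ≠ 0) : y ∈ Subgroup.center H := by
  rw [coord_map_e_one] at hy
  obtain ⟨a, -, ha⟩ := Finset.exists_ne_zero_of_sum_ne_zero hy
  exact mem_center_right_of_coord_ne_zero hψ (left_ne_zero_of_mul ha)

/-- For fixed `h`, `a ↦ u(a)(h)` is a character of `k^G`, multiplicative because the group parts of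
`ψ(e_g # 1)` are central. Hence it is evaluation at a point `w(h)`, and comultiplicativity of `ψ`
makes `w` a homomorphism. -/
theorem exists_projFun_map_e (hψ : Function.Bijective ψ) :
    ∃ w : H →* G, ∀ g h, projFun k H (ψ (e k g 1)) h = if g = w h then 1 else 0 := by
  have hex : ∀ h, ∃ g₀, ∀ g, projFun k H (ψ (e k g 1)) h = if g = g₀ then 1 else 0 := fun h => by
    refine exists_eq_ite (fun g g' => ?_) ?_
    · rw [← projFun_mul_of_forall_mem_center fun y hy => mem_center_of_coord_ne_zero hψ hy,
        ← map_mul, e_mul_e]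
      by_cases hg : g = g' <;> simp [hg]
    · have : ∑ g, projFun k H (ψ (e k g 1)) h = projFun k H (ψ 1) h := by
        rw [one_def]
        simp
      rw [this, map_one, projFun_one, Pi.one_apply]
  choose w hw using hex
  have hmul : ∀ h' h, w (h' * h) = w h' * w h := fun h' h => by
    have h1 : projFun k H (ψ (e k (w h' * w h) 1)) (h' * h)
        = ∑ a, projFun k H (ψ (e k a 1)) h
          * projFun k H (ψ (e k (w h' * w h * a⁻¹) 1)) h' := by
      simp only [projFun_apply, Finset.sum_mul, Finset.mul_sum]
      rw [Finset.sum_comm]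
      conv_rhs => enter [2, y]; rw [Finset.sum_comm]
      simp [sum_coord_mul_coord]
    simp only [hw, mul_ite, mul_one, mul_zero] at h1
    rw [Finset.sum_eq_single (w h)] at h1
    · by_contra hne
      rw [if_neg (Ne.symm hne), if_pos rfl, if_pos (by group)] at h1
      exact zero_ne_one h1
    · intro b _ hb
      simp [hb]
    · simp
  exact ⟨MonoidHom.mk' w hmul, fun g h => hw h g⟩

section Central

variable {v : G →* H} {w : H →* G}
  (hv : ∀ x, projGrp k H (ψ (grp k x)) = MonoidAlgebra.single (v x) 1)
  (hw : ∀ g h, projFun k H (ψ (e k g 1)) h = if g = w h then 1 else 0)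
include hw

/-- Summing the rows over the second index gives the group element `w(h)`; multiplying by the row at
`(1, y)` then isolates the term at `y`. Thus `w(H)` and central elements account for all rows. -/
theorem matrixRow_eq (h y : H) :
    matrixRow ψ h y = MonoidAlgebra.single (w h) 1 * matrixRow ψ 1 y := by
  have : ∑ y', matrixRow ψ h y' = MonoidAlgebra.single (w h) 1 := by
    refine MonoidAlgebra.ext (Finsupp.ext fun g => ?_)
    have := hw g h
    rw [projFun_apply] at this
    simp [coeff_matrixRow, this, Finsupp.single_apply, eq_comm]
  rw [← this, Finset.sum_mul]
  simp [matrixRow_mul]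

theorem mem_center_of_commute_w (hψ : Function.Injective ψ) {c : G}
    (hc : ∀ h, Commute c (w h)) : c ∈ Subgroup.center G := by
  refine mem_center_of_commute_single (k := k)
    (commute_of_commute_matrixRow hψ fun h y => ?_)
  rw [matrixRow_eq hw]
  refine Commute.mul_right ?_ ?_
  · simp [commute_iff_eq, (hc h).eq]
  · exact (commute_of_commute_matrixRow hψ (fun _ _ => commute_matrixRow_one ψ _ _ _) _).symm

theorem coord_map_e_eq (g : G) (h y : H) :
    coord k h y (ψ (e k g 1)) = coord k 1 y (ψ (e k ((w h)⁻¹ * g) 1)) := by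
  rw [← coeff_matrixRow, matrixRow_eq hw]
  simp [coeff_matrixRow]

include hv

theorem w_conj_of_components (x : G) (h : H) :
    x * w ((v x)⁻¹ * h * v x) * x⁻¹ = w h := by
  set g := w ((v x)⁻¹ * h * v x) with hg
  -- Apply `ψ` to the relation moving `ε # x` past `e_g # 1` and evaluate at `h`. The nonzero scalar
  -- `r(x, h)` appears on both sides and cancels.
  have h1 : projFun k H (ψ (grp k x) * ψ (e k g 1)) h
      = projFun k H (ψ (e k (x * g * x⁻¹) 1) * ψ (grp k x)) h := by
    rw [← map_mul, grp_mul_e_one, map_mul]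
  rw [map_grp_eq hv x, projFun_sum_smul_e_mul,
    projFun_mul_sum_smul_e (fun y h => projFun_map_grp_conj x y h), hw, hw, if_pos hg,
    mul_comm] at h1
  have h2 := mul_right_cancel₀ (projFun_map_grp_ne_zero x h) h1
  by_contra hne
  rw [if_neg hne] at h2
  exact one_ne_zero h2

/-- `w(v x)` and `x` conjugate `w(H)` in the same way, so `w(v x) x⁻¹` commutes with `w(H)`, which
suffices for centrality. -/
theorem w_v_of_components (hψ : Function.Bijective ψ) (x : G) :
    x⁻¹ * w (v x) ∈ Subgroup.center G := by
  have hc : w (v x) * x⁻¹ ∈ Subgroup.center G := by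
    refine mem_center_of_commute_w hw hψ.1 fun h => ?_
    have := w_conj_of_components hv hw x h
    simp only [map_mul, map_inv] at this
    rw [commute_iff_eq]
    conv_lhs => rw [← this]
    group
  have := Subgroup.Normal.conj_mem inferInstance _ hc x⁻¹
  convert this using 1
  group

end Central

theorem mem_center_of_commute_v (hψ : Function.Bijective ψ) {v : G →* H}
    (hv : ∀ x, projGrp k H (ψ (grp k x)) = MonoidAlgebra.single (v x) 1) {c : H}
    (hc : ∀ x, Commute c (v x)) : c ∈ Subgroup.center H := by
  refine mem_center_of_commute_single (k := k)
    (commute_of_commute_projGrp hψ.2 (fun g => (commute_projGrp_map_e hψ g _).symm) fun x => ?_)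
  simp [hv, commute_iff_eq, (hc x).eq]

/-- If `ψ(a) = e_1 # h`, then `h` occurs in some product `p(e_g) v(x)`, and `p(e_g)` has central
support. -/
theorem exists_center_mul_v (hψ : Function.Bijective ψ) {v : G →* H}
    (hv : ∀ x, projGrp k H (ψ (grp k x)) = MonoidAlgebra.single (v x) 1) (h : H) :
    ∃ y ∈ Subgroup.center H, ∃ x, h = y * v x := by
  obtain ⟨a, ha⟩ := hψ.2 (e k 1 h)
  have h1 : (projGrp k H (ψ a)).coeff h = 1 := by
    rw [ha, coeff_projGrp, coord_e, if_pos ⟨rfl, rfl⟩]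
  rw [← sum_coord_smul_e a] at h1
  simp only [map_sum, map_smul, MonoidAlgebra.coeff_sum, MonoidAlgebra.coeff_smul,
    Finsupp.finsetSum_apply, Finsupp.smul_apply] at h1
  obtain ⟨g, -, hg⟩ := Finset.exists_ne_zero_of_sum_ne_zero (h1.trans_ne one_ne_zero)
  obtain ⟨x, -, hx⟩ := Finset.exists_ne_zero_of_sum_ne_zero hg
  rw [projGrp_map_e, hv, MonoidAlgebra.coeff_mul_single_apply, mul_one, coeff_projGrp] at hx
  exact ⟨h * (v x)⁻¹, mem_center_right_of_coord_ne_zero hψ (right_ne_zero_of_smul hx), x,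
    by group⟩

theorem v_w_of_components (hψ : Function.Bijective ψ) {v : G →* H} {w : H →* G}
    (hv : ∀ x, projGrp k H (ψ (grp k x)) = MonoidAlgebra.single (v x) 1)
    (hw : ∀ g h, projFun k H (ψ (e k g 1)) h = if g = w h then 1 else 0) (h : H) :
    h⁻¹ * v (w h) ∈ Subgroup.center H := by
  have hvc : ∀ z ∈ Subgroup.center G, v z ∈ Subgroup.center H := fun z hz =>
    mem_center_of_commute_v hψ hv fun x => by
      rw [commute_iff_eq, ← map_mul, ← map_mul, Subgroup.mem_center_iff.1 hz]
  have hwc : ∀ y ∈ Subgroup.center H, w y ∈ Subgroup.center G := fun y hy =>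
    mem_center_of_commute_w hw hψ.1 fun x => by
      rw [commute_iff_eq, ← map_mul, ← map_mul, Subgroup.mem_center_iff.1 hy]
  -- Since `v` and `w` preserve centers, the central factor `y` is harmless and the claim reduces to
  -- `w(v x)` agreeing with `x` modulo the center.
  obtain ⟨y, hy, x, rfl⟩ := exists_center_mul_v hψ hv h
  have h1 : y⁻¹ * v (w y) ∈ Subgroup.center H := mul_mem (inv_mem hy) (hvc _ (hwc y hy))
  have h2 : v (x⁻¹ * w (v x)) ∈ Subgroup.center H := hvc _ (w_v_of_components hv hw hψ x)
  convert mul_mem h1 h2 using 1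
  have h3 := Subgroup.mem_center_iff.1 h1 (v x)⁻¹
  simp only [map_mul, map_inv, mul_inv_rev] at h3 ⊢
  rw [← mul_assoc _ (v x)⁻¹, ← h3]
  group

/-- A bijective morphism `D(G) → D(H)` has components in `CentralData`. -/
theorem exists_eq_toBialgHom (hψ : Function.Bijective ψ) :
    ∃ d : CentralData k G H, d.toBialgHom = ψ := by
  obtain ⟨v, hv⟩ := exists_projGrp_map_grp ψ
  obtain ⟨w, hw⟩ := exists_projFun_map_e hψ
  let d : CentralData k G H :=
    { p := fun g h => coord k 1 h (ψ (e k g 1))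
      r := fun x h => projFun k H (ψ (grp k x)) h
      v := v
      w := w
      mem_center_left := mem_center_left_of_coord_ne_zero hψ.1
      mem_center_right := mem_center_right_of_coord_ne_zero hψ
      sum_p_left := sum_coord_one_left
      sum_p_right := sum_coord_one_right
      conv_left := conv_coord_left
      conv_right := conv_coord_right
      r_one_left := fun h => by rw [grp_one, map_one, projFun_one, Pi.one_apply]
      r_one_right := projFun_map_grp_one
      r_mul_left := projFun_map_grp_mul_left ψ
      r_mul_right := projFun_map_grp_mul
      w_v := w_v_of_components hv hw hψ
      v_w := v_w_of_components hψ hv hw }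
  refine ⟨d, ?_⟩
  have : (d.toBialgHom : DrinfeldDouble k G →ₗ[k] DrinfeldDouble k H) = ψ := by
    refine hom_ext fun g x => ext_coord fun h y => (d.coord_toBialgHom g x h y).trans ?_
    change _ = coord k h y (ψ (e k g x))
    -- Here `g * w(h)⁻¹` must be matched with the `w(h)⁻¹ * g` of `coord_map_e_eq`; `p` does not
    -- distinguish them.
    rw [← d.p_mul_comm_left, ← e_one_mul_grp, map_mul, map_grp_eq hv x,
      coord_mul_sum_smul_e fun y h => projFun_map_grp_conj x y h, coord_map_e_eq hw]
  exact DFunLike.ext _ _ fun z => LinearMap.congr_fun this z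

end Structure

theorem exists_isAdjoint {k G H : Type*} [Field k] [Group G] [Fintype G] [DecidableEq G]
    [Group H] [Fintype H] [DecidableEq H] {ψ : DrinfeldDouble k G →ₐc[k] DrinfeldDouble k H}
    (hψ : Function.Bijective ψ) : ∃ φ, IsAdjoint ψ φ := by
  obtain ⟨d, rfl⟩ := exists_eq_toBialgHom hψ
  exact ⟨_, d.isAdjoint_toBialgHom_swap⟩

/-! ### The anti-automorphism of the automorphism group. -/

section Flip

variable {k G : Type*} [Field k] [Group G] [Fintype G] [DecidableEq G]

theorem exists_isAdjoint_equiv (ψ : DrinfeldDouble k G ≃ₐc[k] DrinfeldDouble k G) :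
    ∃ φ, IsAdjoint (ψ : DrinfeldDouble k G →ₐc[k] DrinfeldDouble k G) φ :=
  exists_isAdjoint ψ.bijective

/-- The adjoint of an automorphism of `D(G)`, as a morphism. -/
def adjointHom (ψ : DrinfeldDouble k G ≃ₐc[k] DrinfeldDouble k G) :
    DrinfeldDouble k G →ₐc[k] DrinfeldDouble k G :=
  (exists_isAdjoint_equiv ψ).choose

theorem isAdjoint_adjointHom (ψ : DrinfeldDouble k G ≃ₐc[k] DrinfeldDouble k G) :
    IsAdjoint (ψ : DrinfeldDouble k G →ₐc[k] DrinfeldDouble k G) (adjointHom ψ) :=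
  (exists_isAdjoint_equiv ψ).choose_spec

theorem adjointHom_comp (ψ ψ' : DrinfeldDouble k G ≃ₐc[k] DrinfeldDouble k G) :
    (adjointHom ψ).comp (adjointHom ψ') = adjointHom (ψ' * ψ) :=
  ((isAdjoint_adjointHom ψ).comp (isAdjoint_adjointHom ψ')).unique
    (isAdjoint_adjointHom (ψ' * ψ))

theorem adjointHom_one :
    adjointHom (1 : DrinfeldDouble k G ≃ₐc[k] DrinfeldDouble k G) = BialgHom.id k _ :=
  (isAdjoint_adjointHom 1).unique IsAdjoint.id

/-- The adjoint of an automorphism of `D(G)`, as an automorphism. -/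
def adjointEquiv (ψ : DrinfeldDouble k G ≃ₐc[k] DrinfeldDouble k G) :
    DrinfeldDouble k G ≃ₐc[k] DrinfeldDouble k G :=
  BialgEquiv.ofBialgHom (adjointHom ψ) (adjointHom ψ⁻¹)
    -- Adjunction reverses products and fixes the identity, so the adjoint of `ψ⁻¹` inverts the
    -- adjoint of `ψ`.
    (by rw [adjointHom_comp, inv_mul_cancel, adjointHom_one])
    (by rw [adjointHom_comp, mul_inv_cancel, adjointHom_one])

theorem isAdjoint_adjointEquiv (ψ : DrinfeldDouble k G ≃ₐc[k] DrinfeldDouble k G) :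
    IsAdjoint (ψ : DrinfeldDouble k G →ₐc[k] DrinfeldDouble k G)
      (adjointEquiv ψ : DrinfeldDouble k G →ₐc[k] DrinfeldDouble k G) :=
  isAdjoint_adjointHom ψ

theorem eq_adjointEquiv {ψ φ : DrinfeldDouble k G ≃ₐc[k] DrinfeldDouble k G}
    (h : IsAdjoint (ψ : DrinfeldDouble k G →ₐc[k] DrinfeldDouble k G)
      (φ : DrinfeldDouble k G →ₐc[k] DrinfeldDouble k G)) : adjointEquiv ψ = φ :=
  DFunLike.ext _ _ fun z => DFunLike.congr_fun ((isAdjoint_adjointEquiv ψ).unique h) z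

/-- Taking adjoints, as an anti-automorphism of the group of automorphisms of `D(G)`. -/
def adjointMulEquiv : (DrinfeldDouble k G ≃ₐc[k] DrinfeldDouble k G) ≃*
    (DrinfeldDouble k G ≃ₐc[k] DrinfeldDouble k G)ᵐᵒᵖ where
  toFun ψ := MulOpposite.op (adjointEquiv ψ)
  invFun ψ := adjointEquiv ψ.unop
  left_inv ψ := eq_adjointEquiv (isAdjoint_adjointEquiv ψ).symm
  right_inv ψ := congrArg MulOpposite.op
    (eq_adjointEquiv (isAdjoint_adjointEquiv ψ.unop).symm)
  map_mul' ψ φ := congrArg MulOpposite.op (eq_adjointEquiv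
    ((isAdjoint_adjointEquiv φ).comp (isAdjoint_adjointEquiv ψ)))

theorem isFlip_iff_eq_adjointEquiv (ψ : DrinfeldDouble k G ≃ₐc[k] DrinfeldDouble k G)
    (φ : DrinfeldDouble k G →ₐc[k] DrinfeldDouble k G) :
    IsFlip (ψ : DrinfeldDouble k G →ₐc[k] DrinfeldDouble k G) φ ↔
      φ = (adjointEquiv ψ : DrinfeldDouble k G →ₐc[k] DrinfeldDouble k G) :=
  ⟨fun h => h.unique (isAdjoint_adjointEquiv ψ).isFlip,
    fun h => h ▸ (isAdjoint_adjointEquiv ψ).isFlip⟩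

end Flip

end DrinfeldDouble

end

/-- Every Hopf automorphism of `D(G)` is flippable, its flip is an automorphism, and flipping is
an anti-isomorphism of the group of Hopf automorphisms of `D(G)`. -/
theorem mainTheorem6 (k : Type*) [Field k] [IsAlgClosed k] [CharZero k]
    (G : Type*) [Group G] [Fintype G] [DecidableEq G] :
    (∀ ψ : DrinfeldDouble k G ≃ₐc[k] DrinfeldDouble k G,
      DrinfeldDouble.IsFlippable (ψ : DrinfeldDouble k G →ₐc[k] DrinfeldDouble k G)) ∧
    (∀ (ψ : DrinfeldDouble k G ≃ₐc[k] DrinfeldDouble k G)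
      (φ : DrinfeldDouble k G →ₐc[k] DrinfeldDouble k G),
      DrinfeldDouble.IsFlip (ψ : DrinfeldDouble k G →ₐc[k] DrinfeldDouble k G) φ →
        Function.Bijective φ) ∧
    ∃ F : (DrinfeldDouble k G ≃ₐc[k] DrinfeldDouble k G) ≃*
        (DrinfeldDouble k G ≃ₐc[k] DrinfeldDouble k G)ᵐᵒᵖ,
      ∀ (ψ : DrinfeldDouble k G ≃ₐc[k] DrinfeldDouble k G)
        (φ : DrinfeldDouble k G →ₐc[k] DrinfeldDouble k G),
        DrinfeldDouble.IsFlip (ψ : DrinfeldDouble k G →ₐc[k] DrinfeldDouble k G) φ ↔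
          φ = ((F ψ).unop : DrinfeldDouble k G →ₐc[k] DrinfeldDouble k G) := by

  refine ⟨fun ψ => ⟨_, (DrinfeldDouble.isAdjoint_adjointEquiv ψ).isFlip⟩, fun ψ φ h => ?_,
    DrinfeldDouble.adjointMulEquiv, fun ψ φ => DrinfeldDouble.isFlip_iff_eq_adjointEquiv ψ φ⟩
  rw [DrinfeldDouble.isFlip_iff_eq_adjointEquiv] at h
  subst h
  exact (DrinfeldDouble.adjointEquiv ψ).bijective
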